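/- Let $G=(V,E)$ be a connected graph with $n\ge 2$ vertices (processes), diameter $D$ and distance $d$, and let $\varrho\ge 1$ be an integer. The $\varrho$-LME algorithm is the following protocol. A clock with parameters $(\alpha,K)$ takes values in $\{-\alpha,\dots,K-1\}$, with successor $\varphi(x)=(x+1)\bmod K$ for $x\ge 0$ and $\varphi(x)=x+1$ for $x<0$; values in $\{0,\dots,K-1\}$ form the ring, values in $\{-\alpha,\dots,0\}$ the tail. Each process $p$ has a main clock $r_1$ (parameters $\alpha_1,K_1$), a slave clock $r_2$ (parameters $\alpha_2,K_2$), two registers $res_1,res_2$ that hold pairs (slave clock value, identifier), and a constant identifier $p.id$ in a totally ordered set, such that distinct processes at distance at most $2\varrho$ have distinct identifiers. Here $K_1$ is a multiple of $\varrho+1$, $K_2\ge 4\varrho+1$, and $K_1,K_2>C_G$, where $C_G$ is the cyclomatic characteristic: the smallest length of the longest cycle over all cycle bases of $G$ ($2$ if $G$ is acyclic). For $i\in\{1,2\}$: $NormalStep^i_p$ says that $p.r_i$ is in the ring and $q.r_i\in\{p.r_i,\varphi_i(p.r_i)\}$ for every neighbour $q$ of $p$; $LocallyCorrect^i_p$ says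 that $p.r_i$ and all neighbouring $q.r_i$ are in the ring and each $q.r_i$ equals, is the successor of, or has as successor, $p.r_i$. The actions of $p$ are: * $NA$, with guard $NormalStep^1_p\wedge LocallyCorrect^2_p$. If $p.r_1\equiv\varrho \pmod{\varrho+1}$: when moreover $NormalStep^2_p$ and $(p.r_2,p.id)=p.res_2$ hold, $p$ executes its critical section and sets $p.r_2:=\varphi_2(p.r_2)$; in any case $p$ then sets $p.res_1:=p.res_2:=(p.r_2,p.id)$. Otherwise $p$ sets $p.res_1:=p.res_2$ and $p.res_2:=(p.r_2,p.id)\oplus\bigoplus_{q}q.res_{\omega(q)}$ over its neighbours $q$ (in any order), where $\omega(q)=2$ if $q.r_1=p.r_1$ and $\omega(q)=1$ if $q.r_1=\varphi_1(p.r_1)$. In both cases $p.r_1:=\varphi_1(p.r_1)$. Here $x\oplus y$ is $x$ if $x\blacktriangleleft y$ and $y$ otherwise, where $(r,v)\blacktriangleleft(r',v')$ iff ($r\ne r'$ and $(r'-r)\bmod K_2\le 2\varrho$) or ($r=r'$ and $v\le v'$). * for $i\in\{1,2\}$, the convergence action $p.r_i:=\varphi_i(p.r_i)$, enabled if $p.r_i\in\{-\alpha_i,\dots,-1\}$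 and every neighbouring $q.r_i$ is in the tail with $p.r_i\le q.r_i$; and the reset action $p.r_i:=-\alpha_i$, enabled if $LocallyCorrect^i_p$ fails and $p.r_i$ is not in the tail. In each step the (unfair, distributed) daemon chooses a nonempty set of enabled processes, and each of them atomically executes one enabled action. **Proposition.** Consider any infinite execution of the $\varrho$-LME algorithm that starts in a configuration in which both clocks are stabilized (for $i=1,2$ all $r_i$ are in the ring, and the $r_i$ of neighbouring processes differ by at most $1$ modulo $K_i$); the $res$ registers are arbitrary. Then there is a time $T$ such that in the execution from time $T$ on: 1. the fairness index is $\left\lceil \frac{D}{\varrho}\right\rceil$, i.e. between any two consecutive critical section executions of a process, any other process executes its critical section at most $\left\lceil \frac{D}{\varrho}\right\rceil$ times; 2. if $\varrho\le n$, the service time, i.e. the maximal total number of critical section executions by other processes between two consecutive critical section executions of a process, is at most $\left\lceil \frac{n(n-1)}{\varrho}\right\rceil$. -/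

import Mathlib

open scoped Classical in
/-- Edge indicator, over `𝔽₂`, of a walk. -/
noncomputable def walkEdgeVector {V : Type*} {G : SimpleGraph V} {v : V} (c : G.Walk v v) :
    Sym2 V → ZMod 2 :=
  fun e => if e ∈ c.edges then 1 else 0

/-- The cycle space of `G` over `𝔽₂`: sets of edges of `G` (as `𝔽₂`-vectors) that have even degree
at every vertex. -/
def cycleSpace {V : Type*} [Fintype V] (G : SimpleGraph V) :
    Submodule (ZMod 2) (Sym2 V → ZMod 2) where
  carrier := {f | (∀ e, e ∉ G.edgeSet → f e = 0) ∧ ∀ v : V, ∑ w : V, f s(v, w) = 0}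
  add_mem' := by
    rintro f g ⟨hf, hf'⟩ ⟨hg, hg'⟩
    refine ⟨fun e he => by simp [hf e he, hg e he], fun v => ?_⟩
    simp [Finset.sum_add_distrib, hf' v, hg' v]
  zero_mem' := by simp
  smul_mem' := by
    rintro a f ⟨hf, hf'⟩
    refine ⟨fun e he => by simp [hf e he], fun v => ?_⟩
    simp [← Finset.mul_sum, hf' v]

/-- A cycle basis of `G`: a basis of the cycle space that consists of (edge sets of) cycles. -/
def IsCycleBasis {V : Type*} [Fintype V] (G : SimpleGraph V) (B : Set (Sym2 V → ZMod 2)) : Prop :=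
  (∀ f ∈ B, ∃ (v : V) (c : G.Walk v v), c.IsCycle ∧ walkEdgeVector c = f) ∧
    LinearIndependent (ZMod 2) (fun f : B => (f : Sym2 V → ZMod 2)) ∧
    Submodule.span (ZMod 2) B = cycleSpace G

/-- The length of the longest cycle in `B` (`0` if `B` contains no cycle). -/
noncomputable def longestCycle {V : Type*} (G : SimpleGraph V) (B : Set (Sym2 V → ZMod 2)) : ℕ∞ :=
  ⨆ (v : V) (c : G.Walk v v) (_ : c.IsCycle) (_ : walkEdgeVector c ∈ B), (c.length : ℕ∞)

/-- The cyclomatic characteristic: the smallest length of the longest cycle among all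
cycle bases. The convention for acyclic graphs is `2` (a graph with a cycle has value at least
`3`, so the maximum with `2` only matters for acyclic graphs). -/
noncomputable def cyclomaticCharacteristic {V : Type*} [Fintype V] (G : SimpleGraph V) : ℕ∞ :=
  max 2 (⨅ (B : Set (Sym2 V → ZMod 2)) (_ : IsCycleBasis G B), longestCycle G B)

namespace LayerClock

/-! ### Incrementing systems and the predicates of one clock

A clock with parameters `α`, `K` has the values `-α, …, 0, …, K - 1`; `c p` is the register of the
process `p`. -/

/-- The successor function `φ` of a clock. -/
def incr (K : ℕ) (x : ℤ) : ℤ := if 0 ≤ x then (x + 1) % (K : ℤ) else x + 1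

/-- The expected values `0, …, K - 1`. -/
def ring (K : ℕ) : Set ℤ := Set.Ico 0 (K : ℤ)

/-- The tail `-α, …, 0`. -/
def tail (α : ℕ) : Set ℤ := Set.Icc (-(α : ℤ)) 0

/-- The tail without `0`. -/
def tailStar (α : ℕ) : Set ℤ := tail α \ {0}

def LocallyCorrect {V : Type*} (G : SimpleGraph V) (K : ℕ) (c : V → ℤ) (p : V) : Prop :=
  c p ∈ ring K ∧ ∀ q, G.Adj p q →
    c q ∈ ring K ∧ (c p = c q ∨ c p = incr K (c q) ∨ incr K (c p) = c q)

def NormalStep {V : Type*} (G : SimpleGraph V) (K : ℕ) (c : V → ℤ) (p : V) : Prop :=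
  c p ∈ ring K ∧ ∀ q, G.Adj p q → (c p = c q ∨ c q = incr K (c p))

def ConvergenceStep {V : Type*} (G : SimpleGraph V) (α : ℕ) (c : V → ℤ) (p : V) : Prop :=
  c p ∈ tailStar α ∧ ∀ q, G.Adj p q → c q ∈ tail α ∧ c p ≤ c q

def ResetInit {V : Type*} (G : SimpleGraph V) (α K : ℕ) (c : V → ℤ) (p : V) : Prop :=
  ¬ LocallyCorrect G K c p ∧ c p ∉ tail α

/-- The distance on the torus `0, …, K - 1`. -/
def torusDist (K : ℕ) (a b : ℤ) : ℤ := min ((a - b) % (K : ℤ)) ((b - a) % (K : ℤ))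

/-- The clock is stabilized: all values are expected ones and neighbours are locally comparable. -/
def WU {V : Type*} (G : SimpleGraph V) (K : ℕ) (c : V → ℤ) : Prop :=
  (∀ p, c p ∈ ring K) ∧ ∀ p q, G.Adj p q → torusDist K (c p) (c q) ≤ 1

/-! ### The layer clock specialised to `ϱ`-local mutual exclusion -/

/-- The constants of the algorithm: the radius `ϱ`, and the parameters of the main clock (index 1)
and of the slave clock (index 2). -/
structure Params where
  rho : ℕ
  alpha₁ : ℕ
  K₁ : ℕ
  alpha₂ : ℕ
  K₂ : ℕ

/-- The registers a process writes. The identifier is a constant of the process and is not part of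
the state. -/
structure LocalState (S : Type*) where
  r₁ : ℤ
  r₂ : ℤ
  res₁ : ℤ × S
  res₂ : ℤ × S

abbrev Config (V S : Type*) := V → LocalState S

section Infimum
variable {S : Type*} [LinearOrder S]

/-- The local order `≤ₗ` at distance `2ϱ` on the values of the slave clock. -/
def localLE (P : Params) (a b : ℤ) : Prop :=
  0 ≤ (b - a) % (P.K₂ : ℤ) ∧ (b - a) % (P.K₂ : ℤ) ≤ 2 * (P.rho : ℤ)

/-- The `ϱ`-local ordering on pairs (slave clock value, identifier). -/
def pairLE (P : Params) (x y : ℤ × S) : Prop :=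
  (localLE P x.1 y.1 ∧ x.1 ≠ y.1) ∨ (x.1 = y.1 ∧ x.2 ≤ y.2)

open scoped Classical in
/-- The `ϱ`-local infimum of two pairs. -/
noncomputable def pairInf (P : Params) (x y : ℤ × S) : ℤ × S := if pairLE P x y then x else y

end Infimum

section Algorithm
variable {V S : Type*} [LinearOrder S]

/-- `p` is elected in its ball, `(p.r₂, p.id) = p.res₂`. -/
def Elected (ident : V → S) (γ : Config V S) (p : V) : Prop :=
  ((γ p).r₂, ident p) = (γ p).res₂

/-- At its next step of the main clock `p` is at the end of a phase: the main clock is congruent to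
`ϱ` modulo the length `ϱ + 1` of a phase. -/
def PhaseEnd (P : Params) (γ : Config V S) (p : V) : Prop :=
  (γ p).r₁ ≡ (P.rho : ℤ) [ZMOD ((P.rho : ℤ) + 1)]

/-- The condition under which the action `NA` of `p` contains the critical section. -/
def Privileged (P : Params) (G : SimpleGraph V) (ident : V → S) (γ : Config V S) (p : V) : Prop :=
  PhaseEnd P γ p ∧ NormalStep G P.K₂ (fun q => (γ q).r₂) p ∧ Elected ident γ p

/-- The guarded actions: the normal action, and convergence and reset of the two clocks. -/
inductive Action
  | NA
  | CA₁
  | CA₂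
  | RA₁
  | RA₂

def guard (P : Params) (G : SimpleGraph V) (γ : Config V S) (p : V) : Action → Prop
  | .NA => NormalStep G P.K₁ (fun q => (γ q).r₁) p ∧ LocallyCorrect G P.K₂ (fun q => (γ q).r₂) p
  | .CA₁ => ConvergenceStep G P.alpha₁ (fun q => (γ q).r₁) p
  | .CA₂ => ConvergenceStep G P.alpha₂ (fun q => (γ q).r₂) p
  | .RA₁ => ResetInit G P.alpha₁ P.K₁ (fun q => (γ q).r₁) p
  | .RA₂ => ResetInit G P.alpha₂ P.K₂ (fun q => (γ q).r₂) p

open scoped Classical in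
/-- The register of the neighbour `q` that `p` reads in a computation step: `res₂` if the main
clocks of `p` and `q` agree, and `res₁` if `q` is one step ahead. -/
noncomputable def readRes (γ : Config V S) (p q : V) : ℤ × S :=
  if (γ q).r₁ = (γ p).r₁ then (γ q).res₂ else (γ q).res₁

open scoped Classical in
/-- The result of the normal action of `p` if `p` enumerates its neighbours in the order `l`:
at the end of a phase, the critical section together with the increment of the slave clock
(if `p` is privileged), followed by the initialization; otherwise one computation step of the
local infimum. In both cases the main clock is incremented. -/
noncomputable def normalResult (P : Params) (G : SimpleGraph V) (ident : V → S) (γ : Config V S)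
    (p : V) (l : List V) : LocalState S :=
  if PhaseEnd P γ p then
    let r : ℤ := if Privileged P G ident γ p then incr P.K₂ (γ p).r₂ else (γ p).r₂
    { r₁ := incr P.K₁ (γ p).r₁, r₂ := r, res₁ := (r, ident p), res₂ := (r, ident p) }
  else
    { r₁ := incr P.K₁ (γ p).r₁
      r₂ := (γ p).r₂
      res₁ := (γ p).res₂
      res₂ := (l.map (readRes γ p)).foldl (pairInf P) ((γ p).r₂, ident p) }

/-- `s` is a possible new state of `p` after it executes the given action in `γ`. The neighbours may
be enumerated in any order. -/
def Outcome (P : Params) (G : SimpleGraph V) (ident : V → S) (γ : Config V S) (p : V)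
    (s : LocalState S) : Action → Prop
  | .NA => ∃ l : List V, l.Nodup ∧ (∀ q, q ∈ l ↔ G.Adj p q) ∧ s = normalResult P G ident γ p l
  | .CA₁ => s = { γ p with r₁ := incr P.K₁ (γ p).r₁ }
  | .CA₂ => s = { γ p with r₂ := incr P.K₂ (γ p).r₂ }
  | .RA₁ => s = { γ p with r₁ := -(P.alpha₁ : ℤ) }
  | .RA₂ => s = { γ p with r₂ := -(P.alpha₂ : ℤ) }

/-- An infinite execution under the unfair distributed daemon: in every step a nonempty set of
enabled processes is chosen (`act t p` is the action that `p` executes in step `t`, if any), and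
each chosen process atomically executes one enabled action. -/
def IsExecution (P : Params) (G : SimpleGraph V) (ident : V → S) (γ : ℕ → Config V S)
    (act : ℕ → V → Option Action) : Prop :=
  ∀ t, (∃ p a, act t p = some a) ∧
    (∀ p, act t p = none → γ (t + 1) p = γ t p) ∧
    (∀ p a, act t p = some a → guard P G (γ t) p a ∧ Outcome P G ident (γ t) p (γ (t + 1) p) a)

/-- `p` executes its critical section in step `t`. -/
def ExecutesCS (P : Params) (G : SimpleGraph V) (ident : V → S) (γ : ℕ → Config V S)
    (act : ℕ → V → Option Action) (t : ℕ) (p : V) : Prop :=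
  act t p = some Action.NA ∧ Privileged P G ident (γ t) p

end Algorithm

end LayerClock

/-! ### Fairness index and service time

`cs t p` means that `p` executes its critical section in step `t`. -/

/-- `t < t'` are two consecutive critical section executions of `p`. -/
def ConsecutiveCS {V : Type*} (cs : ℕ → V → Prop) (p : V) (t t' : ℕ) : Prop :=
  t < t' ∧ cs t p ∧ cs t' p ∧ ∀ s, t < s → s < t' → ¬ cs s p

/-- Fairness index `k`: between any two consecutive critical section executions of a process, any
other process executes its critical section at most `k` times. -/
def HasFairnessIndex {V : Type*} (cs : ℕ → V → Prop) (k : ℕ) : Prop :=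
  ∀ p t t', ConsecutiveCS cs p t t' → ∀ q, q ≠ p →
    {s : ℕ | t < s ∧ s < t' ∧ cs s q}.encard ≤ (k : ℕ∞)

/-- Service time: the maximal number of critical section executions by other processes between
two consecutive critical section executions of a process. -/
noncomputable def serviceTime {V : Type*} (cs : ℕ → V → Prop) : ℕ∞ :=
  ⨆ (p : V) (t : ℕ) (t' : ℕ) (_ : ConsecutiveCS cs p t t'),
    {x : ℕ × V | t < x.1 ∧ x.1 < t' ∧ x.2 ≠ p ∧ cs x.1 x.2}.encard

/-! The proof replaces cyclic clocks by integer ones and then compares integer counters. Along an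
edge a stabilized clock changes by -1, 0 or 1. The sum of these changes around a cycle of a suitable
cycle basis is divisible by `K` and smaller than `K` in absolute value, hence zero. A 2-adic
argument extends this from an `𝔽₂`-basis to all closed walks, so the clock lifts to an integer
function that is 1-Lipschitz on the graph (`WU.exists_lift`). Convergence and reset are then never
enabled, and normal steps preserve the lift (`IsExecution.exists_lift`).

Within one phase of the main clock the slave clocks are frozen, and `ϱ` computation steps spread the
minimum of (slave lift, identifier) over balls of radius `ϱ`. Lifts in such a ball differ by at most
`2ϱ`, so `K₂ ≥ 4ϱ + 1` makes the cyclic comparison a genuine linear order there. Hence, once the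
initial registers are flushed, only a minimum of its `ϱ`-ball enters its critical section
(`exists_priorityExecution`).

Two processes within distance `ϱ` therefore alternate: once both have executed, the difference of
their counters stays in an interval of length 1. Chaining `k` such hops gives length `k` at distance
at most `k * ϱ` (`exists_bounds`), so such a process executes at most `k` times while the other
waits. Taking the diameter gives the fairness index. For the service time the bounds `⌈dist / ϱ⌉`
are summed; the sorted distances from a vertex are at most `0, 1, …, n - 1`.

No liveness is needed: if critical sections stop, both claims hold vacuously from then on. -/

/-! ### Integer cochains on closed walks and cycle bases over `𝔽₂`. -/

section WalkSums

variable {V : Type*} {G : SimpleGraph V}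

/-- The sum of the values of `δ` along the darts of a walk. -/
def walkSum {A : Type*} [AddCommGroup A] (δ : V → V → A) :
    {u v : V} → G.Walk u v → A
  | _, _, .nil => 0
  | u, _, .cons (v := v) _ w => δ u v + walkSum δ w

theorem walkSum_append {A : Type*} [AddCommGroup A] (δ : V → V → A) {u v w : V}
    (p : G.Walk u v) (q : G.Walk v w) : walkSum δ (p.append q) = walkSum δ p + walkSum δ q := by
  induction p with
  | nil => simp [walkSum]
  | cons h p ih => simp [walkSum, ih, add_assoc]

theorem walkSum_reverse {A : Type*} [AddCommGroup A] (δ : V → V → A)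
    (hδ : ∀ u v, δ u v = -δ v u) {u v : V} (p : G.Walk u v) :
    walkSum δ p.reverse = -walkSum δ p := by
  induction p with
  | nil => simp [walkSum]
  | cons h p ih =>
    rename_i a b c
    simp only [SimpleGraph.Walk.reverse_cons, walkSum_append, walkSum, ih, add_zero]
    rw [hδ b a]; abel

theorem walkSum_eq_sub_add_mul (δ ε : V → V → ℤ) (h : V → ℤ) (m : ℤ)
    (H : ∀ u v, G.Adj u v → δ u v = h v - h u + m * ε u v) {u v : V} (p : G.Walk u v) :
    walkSum δ p = h v - h u + m * walkSum ε p := by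
  induction p with
  | nil => simp [walkSum]
  | cons hd p ih => simp only [walkSum, ih, H _ _ hd]; ring

theorem abs_walkSum_le (δ : V → V → ℤ) (H : ∀ u v, |δ u v| ≤ 1) {u v : V} (p : G.Walk u v) :
    |walkSum δ p| ≤ p.length := by
  induction p with
  | nil => simp [walkSum]
  | cons hd p ih =>
    simp only [walkSum, SimpleGraph.Walk.length_cons]
    push_cast
    rename_i a b _
    exact (abs_add_le _ _).trans (by linarith [H a b])

-- Modulo 2 the orientation of an edge is immaterial, so the walk sum depends only on edge
-- multiplicities. This links integer cochains to linear functionals on the cycle space.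
open scoped Classical in
theorem walkSum_cast_eq_sum (ε : V → V → ℤ) (η : Sym2 V → ZMod 2)
    (H : ∀ u v, G.Adj u v → η s(u, v) = (ε u v : ZMod 2)) [Fintype V] {u v : V}
    (p : G.Walk u v) :
    ((walkSum ε p : ℤ) : ZMod 2) = ∑ e, η e * (p.edges.count e : ZMod 2) := by
  induction p with
  | nil => simp [walkSum]
  | cons hd p ih =>
    simp only [walkSum, SimpleGraph.Walk.edges_cons, List.count_cons]
    push_cast
    rw [ih, ← H _ _ hd]
    simp [mul_add, Finset.sum_add_distrib, add_comm]

-- Each passage through a vertex uses two edges, so modulo 2 only the endpoints contribute.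
open scoped Classical in
theorem sum_count_edges [Fintype V] {a b : V} (p : G.Walk a b) (v : V) :
    ∑ w, (p.edges.count s(v, w) : ZMod 2) = (if v = a then 1 else 0) + (if v = b then 1 else 0) := by
  induction p with
  | nil => split_ifs <;> simp [CharTwo.add_self_eq_zero]
  | cons hd p ih =>
    rename_i a a' b
    simp only [SimpleGraph.Walk.edges_cons, List.count_cons]
    push_cast
    rw [Finset.sum_add_distrib, ih]
    have hne := hd.ne
    have key : ∑ x, (if (s(a, a') == s(v, x)) = true then (1 : ZMod 2) else 0)
        = (if v = a then 1 else 0) + (if v = a' then 1 else 0) := by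
      simp only [beq_iff_eq, Sym2.eq_iff]
      by_cases h1 : v = a
      · subst h1
        simp [hne, hne.symm]
      · by_cases h2 : v = a'
        · subst h2
          simp [hne, hne.symm]
        · simp [h1, h2, Ne.symm h1, Ne.symm h2]
    rw [key]
    have : ∀ x y z : ZMod 2, x + z + (y + x) = y + z := by decide
    exact this _ _ _

open scoped Classical in
theorem count_edges_mem_cycleSpace [Fintype V] {a : V} (p : G.Walk a a) :
    (fun e => (p.edges.count e : ZMod 2)) ∈ cycleSpace G := by
  refine ⟨fun e he => ?_, fun v => ?_⟩
  · beta_reduce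
    rw [List.count_eq_zero_of_not_mem fun h => he (p.edges_subset_edgeSet h)]
    simp
  · beta_reduce
    rw [sum_count_edges]
    exact CharTwo.add_self_eq_zero _

open scoped Classical in
theorem walkEdgeVector_eq_count {a : V} {p : G.Walk a a} (hp : p.IsCycle) :
    walkEdgeVector p = fun e => (p.edges.count e : ZMod 2) := by
  funext e
  unfold walkEdgeVector
  rw [List.Nodup.count hp.isTrail.edges_nodup]
  split_ifs <;> simp

/-- If the sums of an integer cochain along all closed walks are divisible by `m`, and they vanish
on the cycles of a cycle basis, then they are divisible by `2 * m`. -/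
theorem two_mul_dvd_walkSum [Fintype V] (hG : G.Connected)
    {B : Set (Sym2 V → ZMod 2)} (hB : IsCycleBasis G B) (δ : V → V → ℤ)
    (hδ : ∀ u v, δ u v = -δ v u)
    (hcyc : ∀ (v : V) (c : G.Walk v v), c.IsCycle → walkEdgeVector c ∈ B → walkSum δ c = 0)
    {m : ℤ} (hm : m ≠ 0) (hdvd : ∀ (v : V) (c : G.Walk v v), m ∣ walkSum δ c)
    (v : V) (c : G.Walk v v) : 2 * m ∣ walkSum δ c := by
  classical
  -- Modulo `m` the cochain is the coboundary of `h`, obtained by summing from a base point;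
  -- dividing the remainder by `m` gives `ε`.
  obtain ⟨h, hh⟩ : ∃ h : V → ℤ, ∀ a b, G.Adj a b → m ∣ δ a b - (h b - h a) := by
    refine ⟨fun u => walkSum δ (hG.preconnected v u).some, fun a b hab => ?_⟩
    have := hdvd v (((hG.preconnected v a).some.append (.cons hab .nil)).append
      (hG.preconnected v b).some.reverse)
    rw [walkSum_append, walkSum_append, walkSum_reverse _ hδ] at this
    simp only [walkSum, add_zero] at this
    convert this using 1
    ring
  let ε : V → V → ℤ := fun a b => if G.Adj a b then (δ a b - (h b - h a)) / m else 0
  have hε : ∀ a b, ε a b = -ε b a := by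
    intro a b
    by_cases hab : G.Adj a b
    · simp only [ε, hab, hab.symm, if_true]
      rw [← Int.neg_ediv_of_dvd (hh b a hab.symm), hδ a b]
      congr 1; ring
    · have : ¬ G.Adj b a := fun h => hab h.symm
      simp [ε, hab, this]
  have hδε : ∀ a b, G.Adj a b → δ a b = h b - h a + m * ε a b := by
    intro a b hab
    simp only [ε, hab, if_true]
    rw [Int.mul_ediv_cancel' (hh a b hab)]; ring
  let η : Sym2 V → ZMod 2 := Sym2.lift ⟨fun a b => (ε a b : ZMod 2), fun a b => by
    beta_reduce
    rw [hε a b]; push_cast; exact ZMod.neg_eq_self_mod_two _⟩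
  have hη : ∀ a b, G.Adj a b → η s(a, b) = (ε a b : ZMod 2) := fun a b _ => rfl
  have hclosed : ∀ (a : V) (p : G.Walk a a), walkSum δ p = m * walkSum ε p := by
    intro a p
    rw [walkSum_eq_sub_add_mul δ ε h m hδε p]; ring
  let Φ : (Sym2 V → ZMod 2) →ₗ[ZMod 2] ZMod 2 := ∑ e, η e • LinearMap.proj e
  have hΦ : ∀ f, Φ f = ∑ e, η e * f e := by
    intro f
    simp [Φ, LinearMap.sum_apply]
  -- On basis cycles the sum of `ε` vanishes, so the functional given by `ε` mod 2 vanishes on their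
  -- span, the whole cycle space. Hence the sum of `ε` is even on every closed walk.
  have hker : cycleSpace G ≤ LinearMap.ker Φ := by
    rw [← hB.2.2, Submodule.span_le]
    intro f hf
    obtain ⟨a, p, hp, rfl⟩ := hB.1 f hf
    have h0 := hcyc a p hp hf
    rw [hclosed, mul_eq_zero, or_iff_right hm] at h0
    rw [SetLike.mem_coe, LinearMap.mem_ker, hΦ, walkEdgeVector_eq_count hp,
      ← walkSum_cast_eq_sum ε η hη p, h0]
    simp
  have h2 : ((walkSum ε c : ℤ) : ZMod 2) = 0 := by
    rw [walkSum_cast_eq_sum ε η hη c, ← hΦ]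
    exact hker (count_edges_mem_cycleSpace c)
  rw [ZMod.intCast_zmod_eq_zero_iff_dvd] at h2
  rw [hclosed, mul_comm 2 m]
  exact mul_dvd_mul_left m h2

/-- An integer cochain that vanishes on the cycles of a cycle basis over `𝔽₂` vanishes on all
closed walks. -/
theorem walkSum_eq_zero_of_isCycleBasis [Fintype V] (hG : G.Connected)
    {B : Set (Sym2 V → ZMod 2)} (hB : IsCycleBasis G B) (δ : V → V → ℤ)
    (hδ : ∀ u v, δ u v = -δ v u)
    (hcyc : ∀ (v : V) (c : G.Walk v v), c.IsCycle → walkEdgeVector c ∈ B → walkSum δ c = 0)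
    (v : V) (c : G.Walk v v) : walkSum δ c = 0 := by
  have key : ∀ k : ℕ, ∀ (v : V) (c : G.Walk v v), (2 ^ k : ℤ) ∣ walkSum δ c := by
    intro k
    induction k with
    | zero => simp
    | succ k ih =>
      intro v c
      rw [pow_succ, mul_comm]
      exact two_mul_dvd_walkSum hG hB δ hδ hcyc (by positivity) ih v c
  -- An integer `x` divisible by `2 ^ |x|`, which exceeds `|x|`, is zero.
  refine Int.eq_zero_of_abs_lt_dvd (key (walkSum δ c).natAbs v c) ?_
  rw [← Int.natCast_natAbs]
  exact_mod_cast Nat.lt_two_pow_self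

end WalkSums

/-! ### Lifting a stabilized clock to the integers. -/

namespace LayerClock

/-- The signed difference in `{-1, 0, 1}` of two values at torus distance at most one. -/
def torusStep (K : ℕ) (a b : ℤ) : ℤ :=
  if (b - a) % (K : ℤ) = 1 then 1 else if (a - b) % (K : ℤ) = 1 then -1 else 0

/-- For `K ≥ 3` the residues 1 and -1 are distinct, which is what makes the signed step
antisymmetric. -/
theorem torusStep_spec {K : ℕ} (hK : 3 ≤ K) (a b : ℤ) :
    |torusStep K a b| ≤ 1 ∧ torusStep K a b = -torusStep K b a ∧
      (torusDist K a b ≤ 1 → (K : ℤ) ∣ torusStep K a b - (b - a)) := by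
  have hK' : (3 : ℤ) ≤ K := by exact_mod_cast hK
  have h1 := Int.emod_nonneg (a - b) (show (K : ℤ) ≠ 0 by omega)
  have h2 := Int.emod_nonneg (b - a) (show (K : ℤ) ≠ 0 by omega)
  have e1 : (K : ℤ) ∣ (a - b) % K - (a - b) := ⟨-((a - b) / K), by
    rw [Int.emod_def]; ring⟩
  have e2 : (K : ℤ) ∣ (b - a) % K - (b - a) := ⟨-((b - a) / K), by
    rw [Int.emod_def]; ring⟩
  have hex : ¬ ((a - b) % (K : ℤ) = 1 ∧ (b - a) % (K : ℤ) = 1) := by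
    rintro ⟨h, h'⟩
    rw [h] at e1; rw [h'] at e2
    have h3 := dvd_add e1 e2
    have : (1 - (a - b) + (1 - (b - a)) : ℤ) = 2 := by ring
    rw [this] at h3
    have := Int.le_of_dvd (by norm_num) h3
    omega
  refine ⟨?_, ?_, fun h => ?_⟩
  · unfold torusStep; split_ifs <;> simp
  · unfold torusStep; split_ifs <;> first | rfl | (exfalso; apply hex; constructor <;> assumption)
  · unfold torusStep
    split_ifs with h3 h4
    · rwa [h3] at e2
    · rw [h4] at e1
      obtain ⟨k, hk⟩ := e1
      exact ⟨-k, by linarith⟩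
    · have h5 : (a - b) % (K : ℤ) = 0 ∨ (b - a) % (K : ℤ) = 0 := by
        unfold torusDist at h
        rcases min_le_iff.1 h with h | h <;> omega
      rcases h5 with h5 | h5
      · rw [h5] at e1
        obtain ⟨k, hk⟩ := e1
        exact ⟨-k, by linarith⟩
      · rwa [h5] at e2

/-- If `K` exceeds the cyclomatic characteristic, a stabilized clock lifts to an integer valued
function that changes by at most one along every edge. -/
theorem WU.exists_lift {V : Type*} [Fintype V] {G : SimpleGraph V} (hG : G.Connected) {K : ℕ}
    (hC : cyclomaticCharacteristic G < (K : ℕ∞)) {c : V → ℤ} (hc : WU G K c) :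
    ∃ h : V → ℤ, (∀ p, c p = h p % (K : ℤ)) ∧ ∀ p q, G.Adj p q → |h p - h q| ≤ 1 := by
  classical
  have hK : 3 ≤ K := by
    have : (2 : ℕ∞) < K := lt_of_le_of_lt (le_max_left _ _) hC
    exact_mod_cast this
  obtain ⟨B, hB, hlen⟩ : ∃ B, IsCycleBasis G B ∧ longestCycle G B < K := by
    have := lt_of_le_of_lt (le_max_right _ _) hC
    simpa only [iInf_lt_iff, exists_prop] using this
  let δ : V → V → ℤ := fun u v => torusStep K (c u) (c v)
  have hδ : ∀ u v, δ u v = -δ v u := fun u v => (torusStep_spec hK _ _).2.1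
  have hδ1 : ∀ u v, |δ u v| ≤ 1 := fun u v => (torusStep_spec hK _ _).1
  have hmod : ∀ u v (p : G.Walk u v), (K : ℤ) ∣ walkSum δ p - (c v - c u) := by
    intro u v p
    induction p with
    | nil => simp [walkSum]
    | cons hd p ih =>
      obtain ⟨k, hk⟩ := (torusStep_spec hK _ _).2.2 (hc.2 _ _ hd)
      obtain ⟨l, hl⟩ := ih
      exact ⟨k + l, by simp only [walkSum, δ] at hl ⊢; linarith⟩
  have hzero := walkSum_eq_zero_of_isCycleBasis hG hB δ hδ (by
    intro v p hp hpB
    have hl : (p.length : ℕ∞) ≤ longestCycle G B :=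
      le_iSup_of_le v (le_iSup_of_le p (le_iSup_of_le hp (le_iSup_of_le hpB le_rfl)))
    have hl' : p.length < K := by exact_mod_cast lt_of_le_of_lt hl hlen
    have h0 := hmod v v p
    rw [sub_self, sub_zero] at h0
    refine Int.eq_zero_of_abs_lt_dvd h0 (lt_of_le_of_lt (abs_walkSum_le δ hδ1 p) ?_)
    exact_mod_cast hl')
  obtain ⟨r⟩ := hG.nonempty
  let W : ∀ v, G.Walk r v := fun v => (hG.preconnected r v).some
  -- The lift integrates `δ` from the root `r`; vanishing on closed walks makes the choice of walks
  -- harmless, and the constant `c r` gives the right residues.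
  refine ⟨fun v => walkSum δ (W v) + c r, fun p => ?_, fun p q hpq => ?_⟩
  · have h1 := hmod r p (W p)
    have h2 := hc.1 p
    symm
    rw [Int.emod_eq_iff (by omega)]
    refine ⟨h2.1, by simpa using h2.2, ?_⟩
    obtain ⟨k, hk⟩ := h1
    exact ⟨-k, by linarith⟩
  · have h0 := hzero r (((W p).append (.cons hpq .nil)).append (W q).reverse)
    rw [walkSum_append, walkSum_append, walkSum_reverse _ hδ] at h0
    simp only [walkSum, add_zero] at h0
    have : walkSum δ (W p) + c r - (walkSum δ (W q) + c r) = δ q p := by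
      rw [hδ q p]; linarith
    rw [this]
    exact hδ1 q p

end LayerClock

/-! ### Lifts along an execution. -/

namespace LayerClock

theorem incr_emod {K : ℕ} (hK : 1 ≤ K) (x : ℤ) : incr K (x % K) = (x + 1) % K := by
  unfold incr
  rw [if_pos (Int.emod_nonneg _ (by omega)), Int.emod_add_emod]

theorem eq_of_emod_eq {K : ℕ} {x y : ℤ} (h : x % K = y % K) (hlt : |x - y| < K) : x = y := by
  have h1 : (K : ℤ) ∣ x - y := Int.ModEq.dvd h.symm
  have := Int.eq_zero_of_abs_lt_dvd h1 hlt
  omega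

/-- `h` is an integer valued lift of the stabilized clock `c`. -/
structure ClockLift {V : Type*} (G : SimpleGraph V) (K : ℕ) (c h : V → ℤ) : Prop where
  eq_emod : ∀ p, c p = h p % (K : ℤ)
  abs_sub_le : ∀ p q, G.Adj p q → |h p - h q| ≤ 1

namespace ClockLift

variable {V : Type*} {G : SimpleGraph V} {K : ℕ} {c h : V → ℤ}

theorem mem_ring (hl : ClockLift G K c h) (hK : 3 ≤ K) (p : V) : c p ∈ ring K := by
  rw [hl.eq_emod p]
  exact ⟨Int.emod_nonneg _ (by omega), Int.emod_lt_of_pos _ (by omega)⟩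

theorem locallyCorrect (hl : ClockLift G K c h) (hK : 3 ≤ K) (p : V) : LocallyCorrect G K c p := by
  refine ⟨hl.mem_ring hK p, fun q hq => ⟨hl.mem_ring hK q, ?_⟩⟩
  have h1 := abs_le.1 (hl.abs_sub_le p q hq)
  rw [hl.eq_emod p, hl.eq_emod q, incr_emod (by omega), incr_emod (by omega)]
  have : h p = h q ∨ h p = h q + 1 ∨ h p + 1 = h q := by omega
  rcases this with h2 | h2 | h2 <;> simp [h2]

/-- The integers compared differ by at most `2 < K`, so their residues determine them. -/
theorem eq_or_eq_add_one (hl : ClockLift G K c h) (hK : 3 ≤ K) {p : V} (hp : NormalStep G K c p)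
    {q : V} (hq : G.Adj p q) : h q = h p ∨ h q = h p + 1 := by
  have h1 := abs_le.1 (hl.abs_sub_le p q hq)
  have hlt : ∀ x : ℤ, |x| ≤ 2 → |x| < K := fun x hx => by
    have : (3 : ℤ) ≤ K := by exact_mod_cast hK
    omega
  rcases hp.2 q hq with h2 | h2
  · rw [hl.eq_emod p, hl.eq_emod q] at h2
    exact Or.inl (eq_of_emod_eq h2 (hlt _ (abs_le.2 (by omega)))).symm
  · rw [hl.eq_emod p, hl.eq_emod q, incr_emod (by omega)] at h2
    exact Or.inr (eq_of_emod_eq h2 (hlt _ (abs_le.2 (by omega))))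

theorem not_convergenceStep (hl : ClockLift G K c h) (hK : 3 ≤ K) (α : ℕ) (p : V) :
    ¬ ConvergenceStep G α c p := by
  rintro ⟨⟨h1, h2⟩, -⟩
  have h3 := (hl.mem_ring hK p).1
  exact h2 (le_antisymm h1.2 h3)

theorem not_resetInit (hl : ClockLift G K c h) (hK : 3 ≤ K) (α : ℕ) (p : V) :
    ¬ ResetInit G α K c p :=
  fun h1 => h1.1 (hl.locallyCorrect hK p)

/-- Normal steps of a set of processes preserve the lift. -/
theorem step (hl : ClockLift G K c h) (hK : 3 ≤ K) {c' h' : V → ℤ} {moved : V → Prop}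
    (hmove : ∀ p, moved p → NormalStep G K c p ∧ c' p = incr K (c p) ∧ h' p = h p + 1)
    (hstay : ∀ p, ¬ moved p → c' p = c p ∧ h' p = h p) : ClockLift G K c' h' := by
  refine ⟨fun p => ?_, fun p q hpq => ?_⟩
  · by_cases hp : moved p
    · obtain ⟨-, h2, h3⟩ := hmove p hp
      rw [h2, h3, hl.eq_emod p, incr_emod (by omega)]
    · obtain ⟨h2, h3⟩ := hstay p hp
      rw [h2, h3, hl.eq_emod p]
  · have h1 := abs_le.1 (hl.abs_sub_le p q hpq)
    -- A process moves only when no neighbour is behind it, so its increment cannot open a gap of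
    -- two.
    have key : ∀ u w, G.Adj u w → moved u → h u ≤ h w ∧ h' u = h u + 1 := fun u w huw hu => by
      obtain ⟨h2, -, h3⟩ := hmove u hu
      refine ⟨?_, h3⟩
      rcases hl.eq_or_eq_add_one hK h2 huw with h4 | h4 <;> omega
    rw [abs_le]
    by_cases hp : moved p <;> by_cases hq : moved q
    · have := key p q hpq hp; have := key q p hpq.symm hq; omega
    · have := key p q hpq hp; have := (hstay q hq).2; omega
    · have := key q p hpq.symm hq; have := (hstay p hp).2; omega
    · have := (hstay q hq).2; have := (hstay p hp).2; omega

end ClockLift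

section Lifted

variable {V S : Type*} [LinearOrder S]

/-- An execution with stabilized clocks, together with integer valued lifts `X` of the main clock and
`Y` of the slave clock. -/
structure LiftedExecution (P : Params) (G : SimpleGraph V) (ident : V → S) (γ : ℕ → Config V S)
    (act : ℕ → V → Option Action) (X Y : ℕ → V → ℤ) : Prop where
  main : ∀ t, ClockLift G P.K₁ (fun p => (γ t p).r₁) (X t)
  slave : ∀ t, ClockLift G P.K₂ (fun p => (γ t p).r₂) (Y t)
  idle : ∀ t p, act t p ≠ some .NA →
    γ (t + 1) p = γ t p ∧ X (t + 1) p = X t p ∧ Y (t + 1) p = Y t p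
  succ_main : ∀ t p, act t p = some .NA → X (t + 1) p = X t p + 1
  adj_main : ∀ t p, act t p = some .NA → ∀ q, G.Adj p q → X t q = X t p ∨ X t q = X t p + 1
  result : ∀ t p, act t p = some .NA →
    ∃ l : List V, (∀ q, q ∈ l ↔ G.Adj p q) ∧ γ (t + 1) p = normalResult P G ident (γ t) p l
  succ_slave : ∀ t p, ExecutesCS P G ident γ act t p → Y (t + 1) p = Y t p + 1
  stay_slave : ∀ t p, ¬ ExecutesCS P G ident γ act t p → Y (t + 1) p = Y t p

theorem IsExecution.eq_NA {P : Params} {G : SimpleGraph V} {ident : V → S} {γ : ℕ → Config V S}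
    {act : ℕ → V → Option Action} (hexec : IsExecution P G ident γ act) (hK₁ : 3 ≤ P.K₁)
    (hK₂ : 3 ≤ P.K₂) {t : ℕ} {x y : V → ℤ} (hx : ClockLift G P.K₁ (fun p => (γ t p).r₁) x)
    (hy : ClockLift G P.K₂ (fun p => (γ t p).r₂) y) {p : V} {a : Action} (ha : act t p = some a) :
    a = .NA := by
  have h := ((hexec t).2.2 p a ha).1
  cases a with
  | NA => rfl
  | CA₁ => exact absurd h (hx.not_convergenceStep hK₁ _ _)
  | CA₂ => exact absurd h (hy.not_convergenceStep hK₂ _ _)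
  | RA₁ => exact absurd h (hx.not_resetInit hK₁ _ _)
  | RA₂ => exact absurd h (hy.not_resetInit hK₂ _ _)

theorem normalResult_r₁ (P : Params) (G : SimpleGraph V) (ident : V → S) (γ : Config V S)
    (p : V) (l : List V) : (normalResult P G ident γ p l).r₁ = incr P.K₁ (γ p).r₁ := by
  unfold normalResult; split_ifs <;> rfl

open scoped Classical in
theorem normalResult_r₂ (P : Params) (G : SimpleGraph V) (ident : V → S) (γ : Config V S)
    (p : V) (l : List V) : (normalResult P G ident γ p l).r₂ =
      if Privileged P G ident γ p then incr P.K₂ (γ p).r₂ else (γ p).r₂ := by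
  unfold normalResult
  split_ifs with h1 h2 h2
  · rfl
  · rfl
  · exact absurd h2.1 h1
  · rfl

/-- The clocks of an execution with stabilized clocks lift to integer valued clocks. -/
theorem IsExecution.exists_lift [Fintype V] {P : Params} {G : SimpleGraph V} (hG : G.Connected)
    (hC₁ : cyclomaticCharacteristic G < (P.K₁ : ℕ∞))
    (hC₂ : cyclomaticCharacteristic G < (P.K₂ : ℕ∞)) {ident : V → S} {γ : ℕ → Config V S}
    {act : ℕ → V → Option Action} (hexec : IsExecution P G ident γ act)
    (hWU₁ : WU G P.K₁ (fun p => (γ 0 p).r₁)) (hWU₂ : WU G P.K₂ (fun p => (γ 0 p).r₂)) :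
    ∃ X Y : ℕ → V → ℤ, LiftedExecution P G ident γ act X Y := by
  classical
  have hK : ∀ K : ℕ, cyclomaticCharacteristic G < (K : ℕ∞) → 3 ≤ K := fun K h => by
    have : (2 : ℕ∞) < K := lt_of_le_of_lt (le_max_left _ _) h
    exact_mod_cast this
  have hK₁ := hK _ hC₁
  have hK₂ := hK _ hC₂
  obtain ⟨x, hx, hx'⟩ := hWU₁.exists_lift hG hC₁
  obtain ⟨y, hy, hy'⟩ := hWU₂.exists_lift hG hC₂
  -- The lifts are the initial lifts plus the number of increments so far.
  let X : ℕ → V → ℤ := fun t p => x p + Nat.count (fun s => act s p = some .NA) t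
  let Y : ℕ → V → ℤ := fun t p => y p + Nat.count (fun s => ExecutesCS P G ident γ act s p) t
  have hX : ∀ t p, X (t + 1) p = X t p + if act t p = some .NA then 1 else 0 := by
    intro t p
    simp only [X, Nat.count_succ]
    push_cast; ring
  have hY : ∀ t p, Y (t + 1) p = Y t p + if ExecutesCS P G ident γ act t p then 1 else 0 := by
    intro t p
    simp only [Y, Nat.count_succ]
    push_cast; ring
  have hstay : ∀ t, ClockLift G P.K₁ (fun p => (γ t p).r₁) (X t) →
      ClockLift G P.K₂ (fun p => (γ t p).r₂) (Y t) → ∀ p, act t p ≠ some .NA →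
      γ (t + 1) p = γ t p := by
    intro t h1 h2 p hp
    refine (hexec t).2.1 p (Option.eq_none_iff_forall_ne_some.2 fun a ha => ?_)
    have := hexec.eq_NA hK₁ hK₂ h1 h2 ha
    exact hp (this ▸ ha)
  have hinv : ∀ t, ClockLift G P.K₁ (fun p => (γ t p).r₁) (X t) ∧
      ClockLift G P.K₂ (fun p => (γ t p).r₂) (Y t) := by
    intro t
    induction t with
    | zero => exact ⟨⟨by simpa [X] using hx, by simpa [X] using hx'⟩,
        ⟨by simpa [Y] using hy, by simpa [Y] using hy'⟩⟩
    | succ t ih =>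
      refine ⟨ih.1.step hK₁ (moved := fun p => act t p = some .NA) (fun p hp => ?_)
        (fun p hp => ?_), ih.2.step hK₂ (moved := ExecutesCS P G ident γ act t)
        (fun p hp => ?_) (fun p hp => ?_)⟩
      · obtain ⟨hg, l, -, -, hl⟩ := (hexec t).2.2 p _ hp
        exact ⟨hg.1, by rw [hl, normalResult_r₁], by rw [hX, if_pos hp]⟩
      · exact ⟨by rw [hstay t ih.1 ih.2 p hp], by rw [hX, if_neg hp, add_zero]⟩
      · obtain ⟨hg, l, -, -, hl⟩ := (hexec t).2.2 p _ hp.1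
        exact ⟨hp.2.2.1, by rw [hl, normalResult_r₂, if_pos hp.2], by rw [hY, if_pos hp]⟩
      · refine ⟨?_, by rw [hY, if_neg hp, add_zero]⟩
        by_cases hact : act t p = some .NA
        · obtain ⟨hg, l, -, -, hl⟩ := (hexec t).2.2 p _ hact
          rw [hl, normalResult_r₂, if_neg fun h => hp ⟨hact, h⟩]
        · rw [hstay t ih.1 ih.2 p hact]
  refine ⟨X, Y, fun t => (hinv t).1, fun t => (hinv t).2, fun t p hp => ⟨hstay t (hinv t).1
    (hinv t).2 p hp, by rw [hX, if_neg hp, add_zero], ?_⟩, fun t p hp => by rw [hX, if_pos hp],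
    fun t p hp q hq => ?_, fun t p hp => ?_, fun t p hp => by rw [hY, if_pos hp],
    fun t p hp => by rw [hY, if_neg hp, add_zero]⟩
  · rw [hY, if_neg fun h => hp h.1, add_zero]
  · exact (hinv t).1.eq_or_eq_add_one hK₁ ((hexec t).2.2 p _ hp).1.1 hq
  · obtain ⟨hg, l, -, hl, hl'⟩ := (hexec t).2.2 p _ hp
    exact ⟨l, hl, hl'⟩

end Lifted

end LayerClock

/-! ### Counting events that follow a priority order. -/

section Counting

open Finset

/-- A counter that is incremented exactly at the times in `s` counts these times. -/
theorem card_filter_Ioo_eq_sub {s : ℕ → Prop} [DecidablePred s] {h : ℕ → ℤ}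
    (hinc : ∀ t, s t → h (t + 1) = h t + 1) (hstay : ∀ t, ¬ s t → h (t + 1) = h t)
    {t t' : ℕ} (htt' : t < t') :
    (((Ioo t t').filter s).card : ℤ) = h t' - h (t + 1) := by
  induction t', htt' using Nat.le_induction with
  | base => simp
  | succ n hn ih =>
    have : Ioo t (n + 1) = insert n (Ioo t n) := by ext; simp; omega
    rw [this, filter_insert]
    split_ifs with hs
    · rw [card_insert_of_notMem (by simp)]
      push_cast
      rw [ih, hinc n hs]; ring
    · rw [ih, hstay n hs]

theorem SimpleGraph.exists_dist_le_dist_le {V : Type*} {G : SimpleGraph V} (hG : G.Connected)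
    {p q : V} {a b : ℕ} (h : G.dist p q ≤ a + b) : ∃ r, G.dist p r ≤ a ∧ G.dist r q ≤ b := by
  obtain ⟨w, hw⟩ := hG.exists_walk_length_eq_dist p q
  refine ⟨w.getVert a, ?_, ?_⟩
  · exact (SimpleGraph.dist_le (w.take a)).trans (by simp [SimpleGraph.Walk.take_length])
  · refine (SimpleGraph.dist_le (w.drop a)).trans ?_
    rw [SimpleGraph.Walk.drop_length]; omega

/-- A priority order for the events `cs`: `N t p` counts the events of `p` before time `t`, and from
time `T` on an event of `p` at time `t` requires that `(N t p, ident p)` is smaller than the value of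
every other process at distance at most `ϱ`. -/
structure PriorityExecution {V S : Type*} [LinearOrder S] (G : SimpleGraph V) (rho : ℕ)
    (ident : V → S) (cs : ℕ → V → Prop) (N : ℕ → V → ℤ) (T : ℕ) : Prop where
  inc : ∀ t p, cs t p → N (t + 1) p = N t p + 1
  stay : ∀ t p, ¬ cs t p → N (t + 1) p = N t p
  ident_ne : ∀ p q, p ≠ q → G.dist p q ≤ rho → ident p ≠ ident q
  priority : ∀ t p q, T ≤ t → cs t p → p ≠ q → G.dist p q ≤ rho →
    N t p < N t q ∨ (N t p = N t q ∧ ident p ≤ ident q)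

namespace PriorityExecution

variable {V S : Type*} [LinearOrder S] {G : SimpleGraph V} {rho : ℕ} {ident : V → S}
  {cs : ℕ → V → Prop} {N : ℕ → V → ℤ} {T : ℕ}

theorem le_succ (h : PriorityExecution G rho ident cs N T) (t : ℕ) (p : V) :
    N t p ≤ N (t + 1) p := by
  by_cases hc : cs t p
  · rw [h.inc t p hc]; omega
  · rw [h.stay t p hc]

/-- Each event of `p` re-establishes the bound because it required priority over `q`; between events
of `p` only the counter of `q` can grow. The extra 1 comes from a tie, which `p` wins only with the
smaller identifier. -/
theorem le_add_of_cs (h : PriorityExecution G rho ident cs N T) {p q : V} (hpq : p ≠ q)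
    (hd : G.dist p q ≤ rho) {t₀ t : ℕ} (ht₀ : T ≤ t₀) (hcs : cs t₀ p) (ht : t₀ < t) :
    N t p ≤ N t q + (if ident p < ident q then 1 else 0) := by
  have hstep : ∀ s, T ≤ s → cs s p →
      N (s + 1) p ≤ N (s + 1) q + (if ident p < ident q then 1 else 0) := by
    intro s hs hc
    have h1 := h.le_succ s q
    rw [h.inc s p hc]
    rcases h.priority s p q hs hc hpq hd with h2 | ⟨h2, h3⟩
    · split_ifs <;> omega
    · rw [if_pos (lt_of_le_of_ne h3 (h.ident_ne p q hpq hd))]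
      omega
  induction t, ht using Nat.le_induction with
  | base => exact hstep t₀ ht₀ hcs
  | succ s hs ih =>
    by_cases hc : cs s p
    · exact hstep s (by omega) hc
    · rw [h.stay s p hc]
      exact ih.trans (by linarith [h.le_succ s q])

/-- If every process has had an event since time `T`, the counters of two processes at distance at
most `k * ϱ` stay in an interval of length `k`. -/
theorem exists_bounds (h : PriorityExecution G rho ident cs N T) (hG : G.Connected) {T' : ℕ}
    (hT' : ∀ p, ∃ t, T ≤ t ∧ t < T' ∧ cs t p) (p : V) (k : ℕ) :
    ∀ q, G.dist p q ≤ k * rho → ∃ a b : ℤ, a + b ≤ k ∧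
      ∀ t, T' ≤ t → N t p ≤ N t q + a ∧ N t q ≤ N t p + b := by
  induction k with
  | zero =>
    intro q hq
    have : p = q := by
      rw [← hG.dist_eq_zero_iff]; omega
    subst this
    exact ⟨0, 0, by simp⟩
  | succ k ih =>
    intro q hq
    obtain ⟨r, hr, hrq⟩ := SimpleGraph.exists_dist_le_dist_le hG
      (show G.dist p q ≤ k * rho + rho by linarith)
    obtain ⟨a, b, hab, hN⟩ := ih r hr
    by_cases hne : r = q
    · subst hne
      exact ⟨a, b, by push_cast; omega, hN⟩
    obtain ⟨t₁, h1, h1', h1c⟩ := hT' r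
    obtain ⟨t₂, h2, h2', h2c⟩ := hT' q
    -- Exactly one of the two indicators is 1, so each hop adds one to `a + b` rather than two.
    refine ⟨a + if ident r < ident q then 1 else 0, b + if ident q < ident r then 1 else 0, ?_,
      fun t ht => ?_⟩
    · have := h.ident_ne r q hne hrq
      push_cast
      rcases lt_or_gt_of_ne this with h3 | h3
      · rw [if_pos h3, if_neg (not_lt.2 h3.le)]; omega
      · rw [if_pos h3, if_neg (not_lt.2 h3.le)]; omega
    · have h3 := h.le_add_of_cs hne hrq h1 h1c (show t₁ < t by omega)
      have h4 := h.le_add_of_cs (Ne.symm hne) (by rwa [SimpleGraph.dist_comm]) h2 h2c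
        (show t₂ < t by omega)
      have h5 := hN t ht
      constructor <;> linarith [h5.1, h5.2]

open scoped Classical in
/-- Between two consecutive events of `p`, a process at distance at most `k * ϱ` has at most `k`
events. -/
theorem card_filter_Ioo_le (h : PriorityExecution G rho ident cs N T) (hG : G.Connected) {T' : ℕ}
    (hT' : ∀ p, ∃ t, T ≤ t ∧ t < T' ∧ cs t p) {p q : V} {k : ℕ} (hk : G.dist p q ≤ k * rho)
    {t t' : ℕ} (ht : T' ≤ t) (htt' : t < t') (hp : ∀ s, t < s → s < t' → ¬ cs s p) :
    ((Ioo t t').filter (cs · q)).card ≤ k := by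
  obtain ⟨a, b, hab, hN⟩ := h.exists_bounds hG hT' p k q hk
  have hq := card_filter_Ioo_eq_sub (s := (cs · q)) (h := (N · q)) (h.inc · q) (h.stay · q) htt'
  have hp' := card_filter_Ioo_eq_sub (s := (cs · p)) (h := (N · p)) (h.inc · p) (h.stay · p) htt'
  rw [filter_false_of_mem fun s hs => hp s (mem_Ioo.1 hs).1 (mem_Ioo.1 hs).2] at hp'
  -- The counter of `p` agrees at `t + 1` and `t'`, so the counter of `q` rises by at most `a + b`
  -- in between.
  have h1 := hN t' (by omega)
  have h2 := hN (t + 1) (by omega)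
  simp only [card_empty, Nat.cast_zero] at hp'
  have : (((Ioo t t').filter (cs · q)).card : ℤ) ≤ k := by
    rw [hq]; linarith [h1.1, h1.2, h2.1, h2.2]
  exact_mod_cast this

end PriorityExecution

end Counting

/-! ### Sums of rounded distances. -/

section DistanceSums

open Finset

/-- In a connected graph every value between `0` and `dist p q` is a distance from `p`. -/
theorem SimpleGraph.exists_dist_eq_of_le {V : Type*} {G : SimpleGraph V} (hG : G.Connected)
    {p q : V} {k : ℕ} (hk : k ≤ G.dist p q) : ∃ r, G.dist p r = k := by
  obtain ⟨r, h1, h2⟩ := SimpleGraph.exists_dist_le_dist_le hG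
    (show G.dist p q ≤ k + (G.dist p q - k) by omega)
  exact ⟨r, by have := hG.dist_triangle (u := p) (v := r) (w := q); omega⟩

/-- The distances from a vertex, in increasing order, are bounded by `0, 1, 2, …`. -/
theorem SimpleGraph.exists_equiv_dist_le {V : Type*} [Fintype V] {G : SimpleGraph V}
    (hG : G.Connected) (p : V) :
    ∃ e : Fin (Fintype.card V) ≃ V, ∀ i, G.dist p (e i) ≤ i := by
  classical
  let e₀ := (Fintype.equivFin V).symm
  let f : Fin (Fintype.card V) → ℕ := fun i => G.dist p (e₀ i)
  refine ⟨(Tuple.sort f).trans e₀, fun i => ?_⟩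
  have hmono : Monotone (f ∘ Tuple.sort f) := Tuple.monotone_sort f
  change (f ∘ Tuple.sort f) i ≤ i
  -- All smaller distances occur as well, and in sorted order they must occupy positions before `i`.
  have hsub : range ((f ∘ Tuple.sort f) i) ⊆ (Iio i).image (f ∘ Tuple.sort f) := by
    intro k hk
    rw [mem_range] at hk
    obtain ⟨r, hr⟩ := SimpleGraph.exists_dist_eq_of_le hG hk.le
    have hj : (f ∘ Tuple.sort f) ((Tuple.sort f).symm (e₀.symm r)) = k := by simp [f, hr]
    rw [mem_image]
    refine ⟨_, ?_, hj⟩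
    rw [mem_Iio]
    refine lt_of_not_ge fun hle => ?_
    have := hmono hle
    omega
  have hcard := (card_le_card hsub).trans card_image_le
  rwa [card_range, Fin.card_Iio] at hcard

theorem le_ceil_div_mul {d rho : ℕ} (hrho : 1 ≤ rho) : d ≤ ⌈(d : ℚ) / (rho : ℚ)⌉₊ * rho := by
  have h : (d : ℚ) / rho ≤ ⌈(d : ℚ) / (rho : ℚ)⌉₊ := Nat.le_ceil _
  have hr : (0 : ℚ) < rho := by exact_mod_cast hrho
  rw [div_le_iff₀ hr] at h
  exact_mod_cast h

/-- The summand is `⌈d / rho⌉`, constant on blocks of length `rho`. Writing `n - 1 = a * rho + b`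
gives the closed form in `key`; for `a ≥ 1` the estimate `a + 1 ≤ 2 * a` suffices. -/
theorem rho_mul_sum_ceil_le (rho n : ℕ) (hrho : 1 ≤ rho) (hn : rho ≤ n) :
    rho * ∑ d ∈ range n, ((d + (rho - 1)) / rho) ≤ n * (n - 1) := by
  have key : ∀ N a b : ℕ, N = a * rho + b → b < rho →
      2 * ∑ d ∈ range (N + 1), ((d + (rho - 1)) / rho) = rho * (a * (a + 1)) + 2 * (b * (a + 1)) := by
    intro N
    induction N with
    | zero =>
      intro a b h hb
      have h1 : a * rho = 0 := by omega
      have h2 : b = 0 := by omega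
      rcases Nat.mul_eq_zero.1 h1 with rfl | h3
      · subst h2
        simp [Nat.div_eq_of_lt (show rho - 1 < rho by omega)]
      · omega
    | succ N ih =>
      intro a b h hb
      rw [sum_range_succ, mul_add]
      rcases Nat.eq_zero_or_pos b with rfl | hb0
      · obtain ⟨a, rfl⟩ : ∃ a', a = a' + 1 :=
          Nat.exists_eq_succ_of_ne_zero (by rintro rfl; simp at h)
        have hN : N = a * rho + (rho - 1) := by
          rw [add_mul] at h; omega
        have hdiv : (N + 1 + (rho - 1)) / rho = a + 1 := by
          rw [h]
          simp only [add_zero]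
          rw [Nat.mul_comm, Nat.mul_add_div (by omega), Nat.div_eq_of_lt (by omega)]
        rw [ih a (rho - 1) hN (by omega), hdiv]
        obtain ⟨r, rfl⟩ : ∃ r, rho = r + 1 := ⟨rho - 1, by omega⟩
        simp only [Nat.add_sub_cancel]
        ring
      · obtain ⟨b, rfl⟩ : ∃ b', b = b' + 1 := ⟨b - 1, by omega⟩
        have hdiv : (N + 1 + (rho - 1)) / rho = a + 1 := by
          have : N + 1 + (rho - 1) = rho * (a + 1) + b := by
            rw [h, mul_add, mul_comm rho a]; omega
          rw [this, Nat.mul_add_div (by omega), Nat.div_eq_of_lt (by omega)]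
        rw [ih a b (by omega) (by omega), hdiv]
        ring
  obtain ⟨N, rfl⟩ : ∃ N, n = N + 1 := ⟨n - 1, by omega⟩
  have hN := Nat.div_add_mod N rho
  have hlt := Nat.mod_lt N (show 0 < rho by omega)
  set a := N / rho
  set b := N % rho
  have h := key N a b (by rw [← hN, mul_comm]) hlt
  rw [Nat.add_sub_cancel]
  have h2 : 2 * (rho * ∑ d ∈ range (N + 1), ((d + (rho - 1)) / rho))
      = rho * (rho * (a * (a + 1)) + 2 * (b * (a + 1))) := by rw [← h]; ring
  -- For `a = 0` every nonzero summand is 1, and the bound rests on `rho ≤ n`.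
  rcases Nat.eq_zero_or_pos a with h0 | h0
  · rw [h0] at h2 hN
    have : rho * b ≤ (b + 1) * b := Nat.mul_le_mul_right _ (by omega)
    have hb : N = b := by omega
    rw [hb] at h2 ⊢
    linarith
  · have h3 : rho * rho * (a * (a + 1)) ≤ rho * rho * (a * (2 * a)) := by gcongr; omega
    have h4 : rho * b * (a + 1) ≤ rho * b * (2 * a) := by gcongr; omega
    generalize ∑ d ∈ range (N + 1), ((d + (rho - 1)) / rho) = X at h2 ⊢
    have h5 : 0 ≤ rho * a := Nat.zero_le _
    have h6 : 0 ≤ b * b := Nat.zero_le _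
    rw [← hN]
    ring_nf at h2 h3 h4 h5 h6 ⊢
    linarith

end DistanceSums

theorem SimpleGraph.Connected.abs_sub_le_dist {V : Type*} {G : SimpleGraph V} (hG : G.Connected)
    {f : V → ℤ} (hf : ∀ p q, G.Adj p q → |f p - f q| ≤ 1) (p q : V) :
    |f p - f q| ≤ G.dist p q := by
  obtain ⟨w, hw⟩ := hG.exists_walk_length_eq_dist p q
  rw [← hw]
  clear hw
  induction w with
  | nil => simp
  | cons h w ih =>
    have h1 := hf _ _ h
    rw [SimpleGraph.Walk.length_cons]
    push_cast
    rw [abs_le] at *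
    omega

/-! ### The local infimum and its computation within a phase. -/

namespace LayerClock

section LocalInfimum

variable {V S : Type*} [LinearOrder S]

/-- The pair (slave clock value, identifier) of a process, where `L` lifts the slave clock. -/
def clockPair (P : Params) (ident : V → S) (L : V → ℤ) (u : V) : ℤ × S := (L u % (P.K₂ : ℤ), ident u)

/-- The priority of a process: the lifted slave clock, then the identifier. -/
def priorityKey (ident : V → S) (L : V → ℤ) (u : V) : ℤ ×ₗ S := toLex (L u, ident u)

theorem priorityKey_le_iff {ident : V → S} {L : V → ℤ} {u w : V} :
    priorityKey ident L u ≤ priorityKey ident L w ↔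
      L u < L w ∨ (L u = L w ∧ ident u ≤ ident w) := by
  simp [priorityKey, Prod.Lex.toLex_le_toLex]

/-- On values at lifted distance at most `2ϱ`, the local order agrees with the order of the lifts. -/
theorem pairLE_clockPair_iff {P : Params} (hK₂ : 4 * P.rho + 1 ≤ P.K₂) {ident : V → S} {L : V → ℤ}
    {u w : V} (h : |L u - L w| ≤ 2 * P.rho) :
    pairLE P (clockPair P ident L u) (clockPair P ident L w) ↔
      priorityKey ident L u ≤ priorityKey ident L w := by
  have hK : (4 * P.rho + 1 : ℤ) ≤ P.K₂ := by exact_mod_cast hK₂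
  have heq : L u % (P.K₂ : ℤ) = L w % (P.K₂ : ℤ) ↔ L u = L w :=
    ⟨fun h' => eq_of_emod_eq h' (by omega), fun h' => by rw [h']⟩
  rw [priorityKey_le_iff]
  simp only [pairLE, localLE, clockPair, ne_eq, heq]
  rw [Int.emod_sub_emod, Int.sub_emod_emod]
  rw [abs_le] at h
  rcases lt_trichotomy (L u) (L w) with h1 | h1 | h1
  · rw [Int.emod_eq_of_lt (by omega) (by omega)]
    simp only [h1, h1.ne, not_false_eq_true, and_true, true_or, iff_true]
    left; omega
  · simp [h1]
  · have : (L w - L u) % (P.K₂ : ℤ) = L w - L u + P.K₂ := by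
      rw [← Int.add_emod_right, Int.emod_eq_of_lt (by omega) (by omega)]
    rw [this]
    simp only [h1.ne', h1.not_gt, false_and, or_false, not_false_eq_true, and_true, iff_false]
    omega

/-- The local order is cyclic globally, but on processes whose lifts are pairwise within `2ϱ` it is
the linear order of the keys. The fold therefore computes a true minimum, whatever the enumeration.
-/
theorem foldl_pairInf {P : Params} (hK₂ : 4 * P.rho + 1 ≤ P.K₂) {ident : V → S} {L : V → ℤ}
    (l : List V) : ∀ u₀ : V,
    (∀ u ∈ u₀ :: l, ∀ w ∈ u₀ :: l, |L u - L w| ≤ 2 * P.rho) →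
    ∃ u ∈ u₀ :: l, (l.map (clockPair P ident L)).foldl (pairInf P) (clockPair P ident L u₀) =
      clockPair P ident L u ∧ ∀ w ∈ u₀ :: l, priorityKey ident L u ≤ priorityKey ident L w := by
  induction l with
  | nil => intro u₀ _; exact ⟨u₀, by simp⟩
  | cons a l ih =>
    intro u₀ h
    simp only [List.map_cons, List.foldl_cons]
    have hiff := pairLE_clockPair_iff hK₂ (ident := ident) (h u₀ (by simp) a (by simp))
    by_cases hle : priorityKey ident L u₀ ≤ priorityKey ident L a
    · obtain ⟨u, hu, h1, h2⟩ := ih u₀ (fun u hu w hw => h u (by simp at hu ⊢; tauto) w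
        (by simp at hw ⊢; tauto))
      refine ⟨u, by simp at hu ⊢; tauto, by rw [pairInf, if_pos (hiff.2 hle), h1], fun w hw => ?_⟩
      rcases List.mem_cons.1 hw with rfl | hw
      · exact h2 _ (by simp)
      rcases List.mem_cons.1 hw with rfl | hw
      · exact (h2 u₀ (by simp)).trans hle
      · exact h2 _ (by simp [hw])
    · obtain ⟨u, hu, h1, h2⟩ := ih a (fun u hu w hw => h u (by simp at hu ⊢; tauto) w
        (by simp at hw ⊢; tauto))
      refine ⟨u, by simp at hu ⊢; tauto, by rw [pairInf, if_neg (mt hiff.1 hle), h1],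
        fun w hw => ?_⟩
      rcases List.mem_cons.1 hw with rfl | hw
      · exact (h2 a (by simp)).trans (le_of_not_ge hle)
      · exact h2 _ hw

/-- `x` is the infimum of the pairs of the processes at distance at most `i` from `p`. -/
def IsBallMin (P : Params) (G : SimpleGraph V) (ident : V → S) (L : V → ℤ) (p : V) (i : ℕ)
    (x : ℤ × S) : Prop :=
  ∃ u, G.dist p u ≤ i ∧ x = clockPair P ident L u ∧
    ∀ w, G.dist p w ≤ i → priorityKey ident L u ≤ priorityKey ident L w

/-- The infimum over a ball is the infimum of the centre and the infima over the next smaller balls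
around its neighbours. -/
theorem IsBallMin.foldl {P : Params} {G : SimpleGraph V} (hG : G.Connected)
    (hK₂ : 4 * P.rho + 1 ≤ P.K₂) {ident : V → S} {L : V → ℤ}
    (hL : ∀ p q, G.Adj p q → |L p - L q| ≤ 1) {p : V} {i : ℕ} (hi : i + 1 ≤ P.rho) {l : List V}
    (hl : ∀ q, q ∈ l ↔ G.Adj p q) {f : V → ℤ × S}
    (hf : ∀ q, G.Adj p q → IsBallMin P G ident L q i (f q)) :
    IsBallMin P G ident L p (i + 1) ((l.map f).foldl (pairInf P) (clockPair P ident L p)) := by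
  have hg : ∀ q, ∃ u, G.Adj p q → G.dist q u ≤ i ∧ f q = clockPair P ident L u ∧
      ∀ w, G.dist q w ≤ i → priorityKey ident L u ≤ priorityKey ident L w := by
    intro q
    by_cases hq : G.Adj p q
    · obtain ⟨u, hu⟩ := hf q hq
      exact ⟨u, fun _ => hu⟩
    · exact ⟨q, fun h => absurd h hq⟩
  choose g hg using hg
  have hmap : l.map f = (l.map g).map (clockPair P ident L) := by
    rw [List.map_map]
    exact List.map_congr_left fun q hq => (hg q ((hl q).1 hq)).2.1
  have hball : ∀ u ∈ p :: l.map g, G.dist p u ≤ i + 1 := by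
    intro u hu
    rcases List.mem_cons.1 hu with rfl | hu
    · simp
    · obtain ⟨q, hq, rfl⟩ := List.mem_map.1 hu
      have hq' := (hl q).1 hq
      have h1 := hG.dist_triangle (u := p) (v := q) (w := g q)
      rw [SimpleGraph.dist_eq_one_iff_adj.2 hq'] at h1
      have := (hg q hq').1
      omega
  obtain ⟨u, hu, h1, h2⟩ := foldl_pairInf hK₂ (ident := ident) (L := L) (l.map g) p
    (fun u hu w hw => by
      refine (hG.abs_sub_le_dist hL u w).trans ?_
      have h1 := hG.dist_triangle (u := u) (v := p) (w := w)
      rw [SimpleGraph.dist_comm (u := u) (v := p)] at h1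
      have := hball u hu
      have := hball w hw
      omega)
  refine ⟨u, hball u hu, by rw [hmap, h1], fun w hw => ?_⟩
  rcases Nat.eq_zero_or_pos (G.dist p w) with h0 | h0
  · rw [hG.dist_eq_zero_iff] at h0
    subst h0
    exact h2 _ (by simp)
  · obtain ⟨q, hpq, hqw⟩ := SimpleGraph.exists_dist_le_dist_le hG
      -- The first vertex `q` of a geodesic from `p` to `w` is a neighbour of `p` whose ball of
      -- radius `i` contains `w`.
      (show G.dist p w ≤ 1 + (G.dist p w - 1) by omega)
    have hadj : G.Adj p q := by
      rw [← SimpleGraph.dist_eq_one_iff_adj]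
      have := hG.dist_triangle (u := p) (v := q) (w := w)
      omega
    exact (h2 (g q) (by simp only [List.mem_cons, List.mem_map]; exact Or.inr ⟨q, (hl q).2 hadj, rfl⟩)).trans
      ((hg q hadj).2.2 w (by omega))

end LocalInfimum

namespace LiftedExecution

variable {V S : Type*} [LinearOrder S] {P : Params} {G : SimpleGraph V} {ident : V → S}
  {γ : ℕ → Config V S} {act : ℕ → V → Option Action} {X Y : ℕ → V → ℤ}

theorem main_mono (h : LiftedExecution P G ident γ act X Y) (p : V) : Monotone (X · p) := by
  refine monotone_nat_of_le_succ fun t => ?_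
  by_cases ha : act t p = some .NA
  · rw [h.succ_main t p ha]; omega
  · rw [(h.idle t p ha).2.1]

theorem slave_mono (h : LiftedExecution P G ident γ act X Y) (p : V) : Monotone (Y · p) := by
  refine monotone_nat_of_le_succ fun t => ?_
  by_cases ha : ExecutesCS P G ident γ act t p
  · rw [h.succ_slave t p ha]; omega
  · rw [h.stay_slave t p ha]

/-- The step in which the main clock of `p` left the value `m`. -/
theorem exists_step (h : LiftedExecution P G ident γ act X Y) {p : V} {m : ℤ} (h0 : X 0 p ≤ m)
    {t : ℕ} (ht : m + 1 ≤ X t p) : ∃ s < t, act s p = some .NA ∧ X s p = m := by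
  induction t with
  | zero => omega
  | succ t ih =>
    by_cases hm : m + 1 ≤ X t p
    · obtain ⟨s, hs, h1⟩ := ih hm
      exact ⟨s, by omega, h1⟩
    · by_cases ha : act t p = some .NA
      · have := h.succ_main t p ha
        exact ⟨t, by omega, ha, by omega⟩
      · have := (h.idle t p ha).2.1
        omega

theorem state_eq_of_main_eq (h : LiftedExecution P G ident γ act X Y) {p : V} {t t' : ℕ}
    (htt' : t ≤ t') (hX : X t p = X t' p) : γ t' p = γ t p := by
  induction t', htt' using Nat.le_induction with
  | base => rfl
  | succ s hs ih =>
    have h1 : X t p ≤ X s p := h.main_mono p hs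
    have h2 : X s p ≤ X (s + 1) p := h.main_mono p (Nat.le_succ s)
    by_cases ha : act s p = some .NA
    · have := h.succ_main s p ha
      omega
    · rw [(h.idle s p ha).1, ih (by omega)]

theorem exists_prev_step (h : LiftedExecution P G ident γ act X Y) {p : V} {m : ℤ}
    (h0 : X 0 p ≤ m) {t : ℕ} (ht : X t p = m + 1) :
    ∃ s < t, act s p = some .NA ∧ X s p = m ∧ γ t p = γ (s + 1) p := by
  obtain ⟨s, hs, h1, h2⟩ := h.exists_step h0 ht.ge
  exact ⟨s, hs, h1, h2, h.state_eq_of_main_eq hs (by rw [h.succ_main s p h1, h2, ht])⟩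

theorem phaseEnd_iff (h : LiftedExecution P G ident γ act X Y) (hK₁ : (P.rho + 1) ∣ P.K₁) (t : ℕ)
    (p : V) : PhaseEnd P (γ t) p ↔ X t p ≡ (P.rho : ℤ) [ZMOD ((P.rho : ℤ) + 1)] := by
  have h1 := (h.main t).eq_emod p
  have h2 : ((P.rho : ℤ) + 1) ∣ P.K₁ := by exact_mod_cast hK₁
  unfold PhaseEnd Int.ModEq
  rw [h1, Int.emod_emod_of_dvd _ h2]

/-- Inside a phase, only the last value of the main clock is congruent to `ϱ`. -/
theorem phaseEnd_iff_eq (h : LiftedExecution P G ident γ act X Y) (hK₁ : (P.rho + 1) ∣ P.K₁)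
    {s : ℤ} (hs : ((P.rho : ℤ) + 1) ∣ s) {t : ℕ} {p : V} (h1 : s ≤ X t p) (h2 : X t p ≤ s + P.rho) :
    PhaseEnd P (γ t) p ↔ X t p = s + P.rho := by
  rw [h.phaseEnd_iff hK₁]
  obtain ⟨i, hi⟩ : ∃ i, X t p = s + i := ⟨X t p - s, by ring⟩
  have : X t p % ((P.rho : ℤ) + 1) = i := by
    obtain ⟨k, rfl⟩ := hs
    rw [hi, Int.mul_add_emod_self_left, Int.emod_eq_of_lt (by omega) (by omega)]
  unfold Int.ModEq
  rw [this, Int.emod_eq_of_lt (by omega) (by omega)]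
  omega

/-- The slave clock moves only in the step at the end of a phase, and that step takes the main clock
out of the phase. -/
theorem slave_eq_of_same_phase (h : LiftedExecution P G ident γ act X Y)
    (hK₁ : (P.rho + 1) ∣ P.K₁) {s : ℤ} (hs : ((P.rho : ℤ) + 1) ∣ s) {p : V} {t t' : ℕ}
    (htt' : t ≤ t') (h1 : s ≤ X t p) (h2 : X t' p ≤ s + P.rho) : Y t' p = Y t p := by
  induction t', htt' using Nat.le_induction with
  | base => rfl
  | succ r hr ih =>
    have h3 : X t p ≤ X r p := h.main_mono p hr
    have h4 : X r p ≤ X (r + 1) p := h.main_mono p (Nat.le_succ r)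
    rw [h.stay_slave r p, ih (by omega)]
    rintro ⟨ha, hp, -⟩
    rw [h.phaseEnd_iff_eq hK₁ hs (by omega) (by omega)] at hp
    have := h.succ_main r p ha
    omega

/-- `L` gives the values of the lifted slave clocks during the phase that begins at `s`. -/
def IsPhaseValue (P : Params) (X Y : ℕ → V → ℤ) (s : ℤ) (L : V → ℤ) : Prop :=
  ∀ t q, s ≤ X t q → X t q ≤ s + P.rho → Y t q = L q

/-- Processes pass a phase at different times, so `L` need not come from one configuration. It is
still 1-Lipschitz: when `p` leaves `s`, a neighbour is at `s` or `s + 1`, inside the phase since `ϱ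
≥ 1`, so both values are visible at once. -/
theorem exists_isPhaseValue (h : LiftedExecution P G ident γ act X Y)
    (hK₁ : (P.rho + 1) ∣ P.K₁) (hrho : 1 ≤ P.rho) {s : ℤ} (hs : ((P.rho : ℤ) + 1) ∣ s)
    (h0 : ∀ q, X 0 q ≤ s) (hX : ∀ q, ∃ t, s + 1 ≤ X t q) :
    ∃ L, IsPhaseValue P X Y s L ∧ ∀ p q, G.Adj p q → |L p - L q| ≤ 1 := by
  have hstep : ∀ q, ∃ t, act t q = some .NA ∧ X t q = s := fun q => by
    obtain ⟨t, ht⟩ := hX q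
    obtain ⟨r, -, h1⟩ := h.exists_step (h0 q) ht
    exact ⟨r, h1⟩
  choose τ hτ hτs using hstep
  have hL : IsPhaseValue P X Y s fun q => Y (τ q) q := by
    intro t q h1 h2
    rcases le_total t (τ q) with hle | hle
    · exact (h.slave_eq_of_same_phase hK₁ hs hle h1 (by rw [hτs]; omega)).symm
    · exact h.slave_eq_of_same_phase hK₁ hs hle (hτs q).ge h2
  refine ⟨_, hL, fun p q hpq => ?_⟩
  have h1 := h.adj_main (τ p) p (hτ p) q hpq
  rw [hτs p] at h1
  have h2 : Y (τ p) q = Y (τ q) q := hL (τ p) q (by omega) (by omega)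
  rw [← h2]
  exact (h.slave (τ p)).abs_sub_le p q hpq

theorem fst_eq (h : LiftedExecution P G ident γ act X Y) {s : ℤ} {L : V → ℤ}
    (hL : IsPhaseValue P X Y s L) {t : ℕ} {p : V} (h1 : s ≤ X t p) (h2 : X t p ≤ s + P.rho) :
    ((γ t p).r₂, ident p) = clockPair P ident L p := by
  rw [clockPair, ← hL t p h1 h2, ← (h.slave t).eq_emod p]

/-- After `i` computation steps of a phase, the second register contains the infimum over the ball
of radius `i`. -/
theorem isBallMin_res₂ (h : LiftedExecution P G ident γ act X Y) (hG : G.Connected)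
    (hK₁ : (P.rho + 1) ∣ P.K₁) (hK₁' : 3 ≤ P.K₁) (hK₂ : 4 * P.rho + 1 ≤ P.K₂) {s : ℤ}
    (hs : ((P.rho : ℤ) + 1) ∣ s) (h0 : ∀ q, X 0 q + 1 ≤ s) {L : V → ℤ}
    (hL : IsPhaseValue P X Y s L) (hL' : ∀ p q, G.Adj p q → |L p - L q| ≤ 1) (i : ℕ)
    (hi : i ≤ P.rho) :
    ∀ t p, X t p = s + i → IsBallMin P G ident L p i (γ t p).res₂ := by
  induction i with
  | zero =>
    intro t p ht
    have hpair := h.fst_eq hL (t := t) (p := p) (by omega) (by omega)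
    -- The register was initialized in the closing step of the previous phase; `h0` ensures that
    -- this step belongs to the execution.
    obtain ⟨r, -, ha, hr, hγ⟩ := h.exists_prev_step (p := p) (m := s - 1)
      (by have := h0 p; omega) (t := t) (by push_cast at ht; omega)
    obtain ⟨l, -, hl⟩ := h.result r p ha
    have hend : PhaseEnd P (γ r) p := by
      rw [h.phaseEnd_iff_eq hK₁ (s := s - (P.rho + 1)) (dvd_sub_self_right.2 hs) (by omega)
        (by omega)]
      omega
    refine ⟨p, by simp, ?_, fun w hw => ?_⟩
    · rw [← hpair, hγ, hl, normalResult, if_pos hend]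
    · rw [(hG.dist_eq_zero_iff).1 (Nat.le_zero.1 hw)]
  | succ i ih =>
    have ih := ih (by omega)
    have hprev : ∀ t p, X t p = s + i + 1 → ∃ (r : ℕ) (l : List V), act r p = some .NA ∧ X r p = s + i ∧
        (∀ q, q ∈ l ↔ G.Adj p q) ∧ (γ t p).res₁ = (γ r p).res₂ ∧ (γ t p).res₂ =
          (l.map (readRes (γ r) p)).foldl (pairInf P) (clockPair P ident L p) := by
      intro t p ht
      obtain ⟨r, -, ha, hr, hγ⟩ := h.exists_prev_step (p := p) (m := s + i)
        (by have := h0 p; omega) ht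
      obtain ⟨l, hadj, hl⟩ := h.result r p ha
      have hend : ¬ PhaseEnd P (γ r) p := by
        rw [h.phaseEnd_iff_eq hK₁ hs (by omega) (by omega)]
        omega
      rw [normalResult, if_neg hend, h.fst_eq hL (by omega) (by omega)] at hl
      exact ⟨r, l, ha, hr, hadj, by rw [hγ, hl], by rw [hγ, hl]⟩
    intro t p ht
    obtain ⟨r, l, ha, hr, hadj, -, h2⟩ := hprev t p (by push_cast at ht; omega)
    rw [h2]
    refine IsBallMin.foldl hG hK₂ hL' hi hadj fun q hq => ?_
    have hq' := h.adj_main r p ha q hq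
    unfold readRes
    split_ifs with heq
    · refine ih r q ?_
      have e1 := (h.main r).eq_emod q
      have e2 := (h.main r).eq_emod p
      rw [e1, e2] at heq
      rw [eq_of_emod_eq heq (by rw [abs_lt]; omega), hr]
    -- A neighbour one step ahead has overwritten `res₂`, but its `res₁` keeps the infimum of radius
    -- `i`.
    · have hne : X r q ≠ X r p := fun he => heq (by
        have e1 := (h.main r).eq_emod q
        have e2 := (h.main r).eq_emod p
        rw [e1, e2, he])
      obtain ⟨r', l', ha', hr', -, h1', -⟩ := hprev r q (by omega)
      rw [h1']
      exact ih r' q hr'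

/-- A process that executes its critical section has the highest priority in its ball. -/
theorem priorityKey_le_of_executesCS (h : LiftedExecution P G ident γ act X Y) (hG : G.Connected)
    (hK₁ : (P.rho + 1) ∣ P.K₁) (hK₁' : 3 ≤ P.K₁) (hK₂ : 4 * P.rho + 1 ≤ P.K₂) {s : ℤ}
    (hs : ((P.rho : ℤ) + 1) ∣ s) (h0 : ∀ q, X 0 q + 1 ≤ s) {L : V → ℤ}
    (hL : IsPhaseValue P X Y s L) (hL' : ∀ p q, G.Adj p q → |L p - L q| ≤ 1) {t : ℕ} {p : V}
    (hcs : ExecutesCS P G ident γ act t p) (ht : X t p = s + P.rho) {q : V}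
    (hpq : G.dist p q ≤ P.rho) : priorityKey ident L p ≤ priorityKey ident L q := by
  obtain ⟨u, hu, hres, hmin⟩ :=
    h.isBallMin_res₂ hG hK₁ hK₁' hK₂ hs h0 hL hL' P.rho le_rfl t p ht
  have hel : ((γ t p).r₂, ident p) = (γ t p).res₂ := hcs.2.2.2
  rw [hres, h.fst_eq hL (by omega) (by omega), clockPair, clockPair, Prod.mk.injEq] at hel
  have hdist := hG.abs_sub_le_dist hL' p u
  -- Election compares residues only; `u` lies within distance `ϱ < K₂` of `p`, so the lifts agree.
  have hLu := eq_of_emod_eq hel.1 (by omega)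
  refine le_trans (le_of_eq ?_) (hmin q hpq)
  rw [priorityKey, priorityKey, hLu, hel.2]

/-- Once the arbitrary initial registers are flushed, the critical section executions follow the
priorities. -/
theorem exists_priorityExecution [Fintype V] (h : LiftedExecution P G ident γ act X Y)
    (hG : G.Connected) (hrho : 1 ≤ P.rho) (hK₁ : (P.rho + 1) ∣ P.K₁) (hK₁' : 3 ≤ P.K₁)
    (hK₂ : 4 * P.rho + 1 ≤ P.K₂)
    (hident : ∀ p q : V, p ≠ q → G.dist p q ≤ 2 * P.rho → ident p ≠ ident q)
    (hX : ∀ (m : ℤ) (p : V), ∃ t, m ≤ X t p) :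
    ∃ T, PriorityExecution G P.rho ident (ExecutesCS P G ident γ act) Y T := by
  obtain ⟨M, hM⟩ : ∃ M, ∀ q, X 0 q ≤ M := by
    obtain ⟨M, hM⟩ := (Set.finite_range (X 0)).bddAbove
    exact ⟨M, fun q => hM ⟨q, rfl⟩⟩
  choose τ hτ using hX (M + P.rho + 1)
  refine ⟨Finset.univ.sup τ, h.succ_slave, h.stay_slave,
    fun p q hpq hd => hident p q hpq (by omega), fun t p q ht hcs hpq hd => ?_⟩
  have hMt : M + P.rho + 1 ≤ X t p :=
    (hτ p).trans (h.main_mono p ((Finset.le_sup (Finset.mem_univ p)).trans ht))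
  obtain ⟨s, hs⟩ : ∃ s, X t p = s + P.rho := ⟨X t p - P.rho, by ring⟩
  have hdvd : ((P.rho : ℤ) + 1) ∣ s := by
    have h1 := (h.phaseEnd_iff hK₁ t p).1 hcs.2.1
    have := h1.symm.dvd
    rwa [hs, add_sub_cancel_right] at this
  have h0 : ∀ q, X 0 q + 1 ≤ s := fun q => by have := hM q; omega
  obtain ⟨L, hL, hL'⟩ := h.exists_isPhaseValue hK₁ hrho hdvd
    (fun q => by have := h0 q; omega) (hX (s + 1))
  have hle := h.priorityKey_le_of_executesCS hG hK₁ hK₁' hK₂ hdvd h0 hL hL' hcs hs hd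
  have hXq := abs_le.1 ((hG.abs_sub_le_dist (h.main t).abs_sub_le p q))
  -- The main clock of `q` is at most `ϱ` ahead, so `q` is in the same phase or the next. If it has
  -- already closed the phase, it did not execute: both processes would be minimal in each other's
  -- ball, forcing equal identifiers.
  have hYq : Y t q = L q := by
    by_cases hcase : X t q ≤ s + P.rho
    · exact hL t q (by omega) hcase
    · obtain ⟨r, hr, ha, hXr⟩ := h.exists_step (p := q) (m := s + P.rho)
        (by have := h0 q; omega) (t := t) (by omega)
      have h1 : Y t q = Y (r + 1) q := h.slave_eq_of_same_phase hK₁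
        (s := s + (P.rho + 1)) (dvd_add_self_right.2 hdvd) hr
        (by rw [h.succ_main r q ha]; omega) (by omega)
      rw [h1, h.stay_slave r q, hL r q (by omega) (by omega)]
      intro hcs'
      have hle' := h.priorityKey_le_of_executesCS hG hK₁ hK₁' hK₂ hdvd h0 hL hL' hcs' hXr
        (q := p) (by rwa [SimpleGraph.dist_comm])
      have := le_antisymm hle hle'
      refine hident p q hpq (by omega) ?_
      simpa [priorityKey] using congrArg (fun x => (ofLex x).2) this
  rw [hYq, hL t p (by omega) (by omega)]
  exact priorityKey_le_iff.1 hle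

end LiftedExecution

end LayerClock

/-! ### Fairness index and service time. -/

open Finset in
theorem SimpleGraph.Connected.sum_ceil_dist_le {V : Type*} [Fintype V] {G : SimpleGraph V}
    (hG : G.Connected) {rho : ℕ} (hrho : 1 ≤ rho) (hn : rho ≤ Fintype.card V) (p : V) :
    rho * ∑ q, ((G.dist p q + (rho - 1)) / rho) ≤ Fintype.card V * (Fintype.card V - 1) := by
  obtain ⟨e, he⟩ := SimpleGraph.exists_equiv_dist_le hG p
  refine le_trans (Nat.mul_le_mul_left _ ?_) (rho_mul_sum_ceil_le rho _ hrho hn)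
  rw [← e.sum_comp, ← Fin.sum_univ_eq_sum_range fun d => (d + (rho - 1)) / rho]
  exact sum_le_sum fun i _ => Nat.div_le_div_right (Nat.add_le_add_right (he i) _)

theorem ConsecutiveCS.not_of_shift {V : Type*} {cs : ℕ → V → Prop} {T t t' : ℕ} {p : V}
    (h : ConsecutiveCS (fun t p => cs (T + t) p) p t t') (s : ℕ) (h1 : T + t < s)
    (h2 : s < T + t') : ¬ cs s p := by
  obtain ⟨r, rfl⟩ := Nat.exists_eq_add_of_le (show T ≤ s by omega)
  exact h.2.2.2 r (by omega) (by omega)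

namespace PriorityExecution

open Finset

variable {V S : Type*} [Fintype V] [LinearOrder S] {G : SimpleGraph V} {rho : ℕ} {ident : V → S}
  {cs : ℕ → V → Prop} {N : ℕ → V → ℤ} {T T' : ℕ}

theorem hasFairnessIndex (h : PriorityExecution G rho ident cs N T) (hG : G.Connected)
    (hrho : 1 ≤ rho) (hT' : ∀ p, ∃ t, T ≤ t ∧ t < T' ∧ cs t p) :
    HasFairnessIndex (fun t p => cs (T' + t) p) ⌈(G.diam : ℚ) / (rho : ℚ)⌉₊ := by
  classical
  have : Nonempty V := hG.nonempty
  intro p t t' hc q _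
  have hdist : G.dist p q ≤ ⌈(G.diam : ℚ) / (rho : ℚ)⌉₊ * rho :=
    (SimpleGraph.dist_le_diam (SimpleGraph.connected_iff_ediam_ne_top.1 hG)).trans
      (le_ceil_div_mul hrho)
  have hcard := h.card_filter_Ioo_le hG hT' hdist (t := T' + t) (t' := T' + t') (by omega)
    (by have := hc.1; omega) hc.not_of_shift
  refine (Set.encard_le_encard_of_injOn (f := fun s => T' + s)
    (t := (((Ioo (T' + t) (T' + t')).filter (cs · q) : Finset ℕ) : Set ℕ)) ?_ ?_).trans ?_
  · rintro s ⟨h1, h2, h3⟩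
    simp only [coe_filter, mem_Ioo, Set.mem_ofPred_eq]
    exact ⟨by omega, h3⟩
  · intro a _ b _ hab
    simpa using hab
  · rw [Set.encard_coe_eq_coe_finsetCard]
    exact_mod_cast hcard

theorem serviceTime_le (h : PriorityExecution G rho ident cs N T) (hG : G.Connected)
    (hrho : 1 ≤ rho) (hT' : ∀ p, ∃ t, T ≤ t ∧ t < T' ∧ cs t p) (hn : rho ≤ Fintype.card V) :
    serviceTime (fun t p => cs (T' + t) p) ≤
      ((⌈((Fintype.card V : ℚ) * ((Fintype.card V : ℚ) - 1)) / (rho : ℚ)⌉₊ : ℕ) : ℕ∞) := by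
  classical
  have hpos : 1 ≤ Fintype.card V := hrho.trans hn
  refine iSup_le fun p => iSup_le fun t => iSup_le fun t' => iSup_le fun hc => ?_
  have hcard : ∀ q, ((Ioo (T' + t) (T' + t')).filter (cs · q)).card ≤
      (G.dist p q + (rho - 1)) / rho := fun q => by
    refine h.card_filter_Ioo_le hG hT' ?_ (t := T' + t) (t' := T' + t') (by omega)
      (by have := hc.1; omega) hc.not_of_shift
    have h1 := Nat.div_add_mod (G.dist p q + (rho - 1)) rho
    have h2 := Nat.mod_lt (G.dist p q + (rho - 1)) (show 0 < rho by omega)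
    rw [mul_comm]
    omega
  -- Events are grouped by process so that the individual bounds can be summed; the term of `p`
  -- itself is zero.
  refine (Set.encard_le_encard_of_injOn (f := fun x : ℕ × V => (⟨x.2, T' + x.1⟩ : Σ _ : V, ℕ))
    (t := ((univ.sigma fun q => (Ioo (T' + t) (T' + t')).filter (cs · q) :
      Finset (Σ _ : V, ℕ)) : Set _)) ?_ ?_).trans ?_
  · rintro ⟨s, q⟩ ⟨h1, h2, -, h3⟩
    simp only [coe_sigma, Set.mem_sigma_iff, coe_filter, mem_Ioo, Set.mem_ofPred_eq]
    exact ⟨by simp, by omega, h3⟩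
  · rintro ⟨a, u⟩ _ ⟨b, w⟩ _ hab
    simp only [Sigma.mk.injEq, heq_eq_eq] at hab
    ext
    · simpa using hab.2
    · exact hab.1
  · rw [Set.encard_coe_eq_coe_finsetCard, card_sigma, Nat.cast_le]
    refine (sum_le_sum fun q _ => hcard q).trans ?_
    have h1 := hG.sum_ceil_dist_le hrho hn p
    generalize ∑ q, ((G.dist p q + (rho - 1)) / rho) = X at h1 ⊢
    have hr : (0 : ℚ) < rho := by exact_mod_cast hrho
    have h2 : (X : ℚ) ≤ (Fintype.card V : ℚ) * ((Fintype.card V : ℚ) - 1) / rho := by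
      rw [le_div_iff₀ hr, mul_comm]
      have : ((rho * X : ℕ) : ℚ) ≤ ((Fintype.card V * (Fintype.card V - 1) : ℕ) : ℚ) := by
        exact_mod_cast h1
      push_cast [Nat.cast_sub hpos] at this
      exact this
    exact_mod_cast h2.trans (Nat.le_ceil _)

end PriorityExecution

theorem Monotone.exists_le_of_frequently_lt {f : ℕ → ℤ} (hf : Monotone f)
    (h : ∀ T, ∃ t, T ≤ t ∧ f t < f (t + 1)) (m : ℤ) : ∃ t, m ≤ f t := by
  have key : ∀ k : ℕ, ∃ t, f 0 + k ≤ f t := by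
    intro k
    induction k with
    | zero => exact ⟨0, by simp⟩
    | succ k ih =>
      obtain ⟨t, ht⟩ := ih
      obtain ⟨s, hs, hlt⟩ := h t
      exact ⟨s + 1, by have := hf hs; push_cast; omega⟩
  obtain ⟨t, ht⟩ := key (m - f 0).toNat
  exact ⟨t, by omega⟩

/-! ### Dichotomy for critical sections and conclusion. -/

namespace LayerClock

/-- Either the critical sections stop, or every process executes its critical section infinitely
often. -/
theorem LiftedExecution.eventually_not_or_frequently_executesCS {V S : Type*} [Fintype V]
    [LinearOrder S] {P : Params} {G : SimpleGraph V} {ident : V → S} {γ : ℕ → Config V S}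
    {act : ℕ → V → Option Action} {X Y : ℕ → V → ℤ}
    (h : LiftedExecution P G ident γ act X Y) (hG : G.Connected) :
    (∃ T, ∀ t p, T ≤ t → ¬ ExecutesCS P G ident γ act t p) ∨
      ∀ p T, ∃ t, T ≤ t ∧ ExecutesCS P G ident γ act t p := by
  by_cases hfin : ∀ p, ∃ T, ∀ t, T ≤ t → ¬ ExecutesCS P G ident γ act t p
  · choose τ hτ using hfin
    exact Or.inl ⟨Finset.univ.sup τ, fun t p ht =>
      hτ p t ((Finset.le_sup (Finset.mem_univ p)).trans ht)⟩
  · right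
    push Not at hfin
    obtain ⟨p₀, hp₀⟩ := hfin
    intro p T
    by_contra hcon
    push Not at hcon
    -- The slave lift of `p₀` is unbounded while that of `p` is eventually constant, contradicting
    -- the Lipschitz bound along the graph.
    obtain ⟨t, ht⟩ := (h.slave_mono p₀).exists_le_of_frequently_lt (fun T => by
      obtain ⟨t, ht, hc⟩ := hp₀ T
      exact ⟨t, ht, by have := h.succ_slave t p₀ hc; omega⟩)
      (Y T p + G.dist p₀ p + 1)
    have hconst : ∀ s, T ≤ s → Y s p = Y T p := by
      intro s hs
      induction s, hs using Nat.le_induction with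
      | base => rfl
      | succ s hs ih => rw [h.stay_slave s p (hcon s hs), ih]
    have h1 : Y t p ≤ Y (max t T) p := h.slave_mono p (le_max_left t T)
    have h2 := abs_le.1 (hG.abs_sub_le_dist (h.slave t).abs_sub_le p₀ p)
    have h3 := hconst (max t T) (le_max_right t T)
    omega

end LayerClock

theorem mainTheorem7 {V S : Type*} [Fintype V] [LinearOrder S]
    (G : SimpleGraph V) (hG : G.Connected) (hn : 2 ≤ Fintype.card V)
    (P : LayerClock.Params) (hrho : 1 ≤ P.rho)
    (hK₁ : (P.rho + 1) ∣ P.K₁) (hC₁ : cyclomaticCharacteristic G < (P.K₁ : ℕ∞))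
    (hK₂ : 4 * P.rho + 1 ≤ P.K₂) (hC₂ : cyclomaticCharacteristic G < (P.K₂ : ℕ∞))
    (ident : V → S)
    (hident : ∀ p q : V, p ≠ q → G.dist p q ≤ 2 * P.rho → ident p ≠ ident q)
    (γ : ℕ → LayerClock.Config V S) (act : ℕ → V → Option LayerClock.Action)
    (hexec : LayerClock.IsExecution P G ident γ act)
    (hWU₁ : LayerClock.WU G P.K₁ (fun p => (γ 0 p).r₁))
    (hWU₂ : LayerClock.WU G P.K₂ (fun p => (γ 0 p).r₂)) :
    ∃ T : ℕ,
      HasFairnessIndex (fun t p => LayerClock.ExecutesCS P G ident γ act (T + t) p)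
          ⌈(G.diam : ℚ) / (P.rho : ℚ)⌉₊ ∧
        (P.rho ≤ Fintype.card V →
          serviceTime (fun t p => LayerClock.ExecutesCS P G ident γ act (T + t) p) ≤
            ((⌈((Fintype.card V : ℚ) * ((Fintype.card V : ℚ) - 1)) / (P.rho : ℚ)⌉₊ : ℕ) : ℕ∞)) := by

  classical
  obtain ⟨X, Y, h⟩ := hexec.exists_lift hG hC₁ hC₂ hWU₁ hWU₂
  have hK₁' : 3 ≤ P.K₁ := by
    have : (2 : ℕ∞) < P.K₁ := lt_of_le_of_lt (le_max_left _ _) hC₁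
    exact_mod_cast this
  rcases h.eventually_not_or_frequently_executesCS hG with ⟨T, hT⟩ | hinf
  · refine ⟨T, fun p t t' hc => absurd hc.2.1 (hT _ _ (by omega)), fun _ => ?_⟩
    exact iSup_le fun p => iSup_le fun t => iSup_le fun t' => iSup_le fun hc =>
      absurd hc.2.1 (hT _ _ (by omega))
  · obtain ⟨T, hprio⟩ := h.exists_priorityExecution hG hrho hK₁ hK₁' hK₂ hident fun m p =>
      (h.main_mono p).exists_le_of_frequently_lt (fun T => by
        obtain ⟨t, ht, hc⟩ := hinf p T
        exact ⟨t, ht, by have := h.succ_main t p hc.1; omega⟩) m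
    choose τ hτ hτ' using fun p => hinf p T
    -- The final time also waits until every process has executed once after `T`, as the counter
    -- comparison requires.
    have hT' : ∀ p, ∃ t, T ≤ t ∧ t < Finset.univ.sup τ + 1 ∧
        LayerClock.ExecutesCS P G ident γ act t p := fun p =>
      ⟨τ p, hτ p, Nat.lt_succ_of_le (Finset.le_sup (Finset.mem_univ p)), hτ' p⟩
    exact ⟨_, hprio.hasFairnessIndex hG hrho hT', hprio.serviceTime_le hG hrho hT'⟩
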